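/- Let $(G_j)_{j\ge 1}$ be i.i.d. standard complex Gaussian variables, i.e. the real and imaginary parts of $G_j$ are independent real $\mathcal N(0,1)$ variables. For $\theta\in\mathbb R$ and $n\ge 0$ put $B_n(\theta)=\sum_{j=1}^n G_j e^{2i\pi j\theta}$, fix $\alpha>0$, and let $\varphi(n)=\sqrt{2\alpha n\log n}$ for $n\ge 1$. For $\theta\in[0,1)$ and $n\ge 0$ let $i^n(\theta)=\lfloor 2^n\theta\rfloor$, i.e. the unique $i\in\{0,\dots,2^n-1\}$ with $\theta\in[i2^{-n},(i+1)2^{-n})$. For $q>1$ define \[ D'_\alpha=D'_{\alpha}(q)=\Bigl\{\theta\in[0,1):\ \bigl|B_{\lfloor q^n\rfloor}\bigl(i^n(\theta)2^{-n}\bigr)\bigr|>\varphi(\lfloor q^n\rfloor)\ \text{ for infinitely many } n\Bigr\}, \] and let $\dim$ denote Hausdorff dimension, with $\dim\emptyset=0$. Then: 1. for every $q\in(1,2)$, almost surely $(1-\alpha)\log_2 q\le \dim D'_\alpha\le \max(1-\alpha,0)$; 2. for every $q>2$, almost surely $\dim D'_\alpha=\max(1-\alpha\log_2 q,\,0)$.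 -/

import Mathlib

open MeasureTheory ProbabilityTheory Filter

noncomputable section

/-- The walk `B_n(θ) = G_1 e^{2iπθ} + ⋯ + G_n e^{2iπnθ}`.
The sequence of steps is indexed from `0`, so that `g j` is the step `G_{j+1}`. -/
def walk (g : ℕ → ℂ) (n : ℕ) (θ : ℝ) : ℂ :=
  ∑ j ∈ Finset.range n,
    g j * Complex.exp (2 * (Real.pi : ℂ) * Complex.I * ((j : ℂ) + 1) * (θ : ℂ))

/-- The threshold `φ(n) = √(2 α n log n)`. -/
def threshold (α : ℝ) (n : ℕ) : ℝ :=
  Real.sqrt (2 * α * n * Real.log n)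

/-- The dyadic interval `A_i^n = [i 2⁻ⁿ, (i+1) 2⁻ⁿ)`. -/
def dyadicInterval (n i : ℕ) : Set ℝ :=
  Set.Ico ((i : ℝ) / 2 ^ n) (((i : ℝ) + 1) / 2 ^ n)

/-- The index `i^n(θ)` of the dyadic interval of level `n` that contains `θ ≥ 0`. -/
def dyadicIndex (n : ℕ) (θ : ℝ) : ℕ :=
  ⌊(2 : ℝ) ^ n * θ⌋₊

theorem mem_dyadicInterval_iff {n i : ℕ} {θ : ℝ} (hθ : 0 ≤ θ) :
    θ ∈ dyadicInterval n i ↔ dyadicIndex n θ = i := by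
  have h2 : (0 : ℝ) < 2 ^ n := by positivity
  unfold dyadicInterval dyadicIndex
  rw [Nat.floor_eq_iff (by positivity), Set.mem_Ico, div_le_iff₀ h2, lt_div_iff₀ h2, mul_comm θ]

/-- The limsup fractal `D'_α` of the walk with steps `g`: the angles `θ ∈ [0,1)` such that
`|B_{⌊qⁿ⌋}(i^n(θ) 2⁻ⁿ)| > φ(⌊qⁿ⌋)` for infinitely many `n`. -/
def treeExceptionalSet (g : ℕ → ℂ) (α q : ℝ) : Set ℝ :=
  {θ | θ ∈ Set.Ico (0 : ℝ) 1 ∧ ∃ᶠ n : ℕ in atTop,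
    threshold α ⌊q ^ n⌋₊ < ‖walk g ⌊q ^ n⌋₊ ((dyadicIndex n θ : ℝ) / 2 ^ n)‖}

end

/-! Write N = ⌊qⁿ⌋. All coefficients of the walk have modulus one, so B_N(x)/√N is a standard
complex Gaussian for every x; by its Rayleigh tail, |B_N(x)| > φ(N) has probability N^(-α), about
q^(-αn).

The upper bounds are first moment bounds (`ae_dimH_treeExceptionalSet_le`). If λ > log₂ q, then
almost surely, for large n, the walk at time N changes by at most √N between a dyadic point of level
n and the left end of its cell of level ⌈λn⌉, and a slightly smaller α absorbs this change. Covering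
by the good cells of that level gives a convergent sum of s-th powers when λ(1-s) < α log₂ q.
Letting λ decrease to log₂ q gives 1-α for q < 2; for q > 2 the cells of level n itself (λ = 1) give
1 - α log₂ q.

The lower bounds (`ae_le_dimH_treeExceptionalSet`) rest on independence: by orthogonality of
characters, the values at the multiples of 1/M are independent at times divisible by M
(`iIndepFun_walk`). A cell of level sn holds about M 2^(-sn) such points, each good with probability
near q^(-αn). If the product grows exponentially, the probabilities that some cell has no good point
are summable, so almost surely, for all large n, every cell of level ⌊sn⌋ contains a good cell of
level n. A Cantor set along sparse levels then has dimension close to s (`le_dimH_limsup_dyadic`).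
For q > 2 all M = 2ⁿ dyadic points serve. For q < 2 only M = ⌊qⁿ⌋ independent points are used, which
is where the factor log₂ q and the gap between the two bounds come from. -/

/-! ### The modulus of a standard complex Gaussian -/

open scoped ENNReal in
theorem lintegral_gaussian_radial_tail {t : ℝ} (ht : 0 ≤ t) :
    ∫⁻ r in Set.Ioi t, ENNReal.ofReal (r * Real.exp (-r ^ 2 / 2)) =
      ENNReal.ofReal (Real.exp (-t ^ 2 / 2)) := by
  have hderiv : ∀ x ∈ Set.Ici t, HasDerivAt (fun r : ℝ => -Real.exp (-r ^ 2 / 2))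
      (x * Real.exp (-x ^ 2 / 2)) x := by
    intro x _
    have h : HasDerivAt (fun r : ℝ => -r ^ 2 / 2) (-x) x := by
      have := ((hasDerivAt_pow 2 x).neg).div_const 2
      convert! this using 1
      push_cast
      ring
    convert! h.exp.neg using 1
    ring
  have hlim : Tendsto (fun r : ℝ => -Real.exp (-r ^ 2 / 2)) atTop (nhds 0) := by
    rw [← neg_zero]
    refine (Real.tendsto_exp_atBot.comp ?_).neg
    have : Tendsto (fun r : ℝ => r ^ 2 / 2) atTop atTop :=
      (tendsto_pow_atTop two_ne_zero).atTop_div_const two_pos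
    refine (tendsto_neg_atTop_atBot.comp this).congr fun r => ?_
    simp [neg_div]
  have hpos : ∀ x ∈ Set.Ioi t, 0 ≤ x * Real.exp (-x ^ 2 / 2) := fun x hx =>
    mul_nonneg (ht.trans (le_of_lt hx)) (Real.exp_pos _).le
  have hint := integrableOn_Ioi_deriv_of_nonneg' hderiv hpos hlim
  have hval := integral_Ioi_of_hasDerivAt_of_nonneg' hderiv hpos hlim
  rw [← ofReal_integral_eq_lintegral_ofReal hint
    ((ae_restrict_iff' measurableSet_Ioi).2 (ae_of_all _ hpos)), hval]
  simp

theorem gaussianPDF_mul_gaussianPDF (x y : ℝ) :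
    gaussianPDF 0 1 x * gaussianPDF 0 1 y =
      ENNReal.ofReal ((2 * Real.pi)⁻¹ * Real.exp (-(x ^ 2 + y ^ 2) / 2)) := by
  rw [gaussianPDF, gaussianPDF, ← ENNReal.ofReal_mul (gaussianPDFReal_nonneg _ _ _)]
  congr 1
  simp only [gaussianPDFReal, NNReal.coe_one, mul_one, sub_zero]
  have h : (√(2 * Real.pi))⁻¹ * (√(2 * Real.pi))⁻¹ = (2 * Real.pi)⁻¹ := by
    rw [← mul_inv, Real.mul_self_sqrt (by positivity)]
  rw [mul_mul_mul_comm, h, ← Real.exp_add]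
  congr 2
  ring

/-- In the orthonormal basis 1, i the law is a product of two real Gaussians, whose densities
multiply. -/
theorem stdGaussian_complex_eq_withDensity :
    stdGaussian ℂ = (volume : Measure ℂ).withDensity
      (fun z => ENNReal.ofReal ((2 * Real.pi)⁻¹ * Real.exp (-‖z‖ ^ 2 / 2))) := by
  have h1 : stdGaussian ℂ = ((gaussianReal 0 1).prod (gaussianReal 0 1)).map
      Complex.measurableEquivRealProd.symm := by
    rw [stdGaussian_eq_map_pi_orthonormalBasis Complex.orthonormalBasisOneI,
      ← (measurePreserving_finTwoArrow (gaussianReal 0 1)).map_eq,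
      Measure.map_map (by fun_prop) (by fun_prop)]
    congr 1
    ext x
    simp [Complex.measurableEquivRealProd_symm_apply, Complex.mk_eq_add_mul_I]
  rw [h1, gaussianReal_of_var_ne_zero 0 one_ne_zero,
    prod_withDensity (measurable_gaussianPDF _ _) (measurable_gaussianPDF _ _)]
  refine Measure.ext fun s hs => ?_
  rw [Measure.map_apply (by fun_prop) hs, withDensity_apply _ hs,
    withDensity_apply _ (Complex.measurableEquivRealProd.symm.measurable hs),
    ← Measure.volume_eq_prod,
    ← Complex.volume_preserving_equiv_real_prod.symm.setLIntegral_comp_preimage_emb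
      Complex.measurableEquivRealProd.symm.measurableEmbedding]
  refine setLIntegral_congr_fun (Complex.measurableEquivRealProd.symm.measurable hs) fun p _ => ?_
  rw [gaussianPDF_mul_gaussianPDF, ← Complex.normSq_eq_norm_sq]
  simp [Complex.measurableEquivRealProd_symm_apply, Complex.normSq_apply, sq]

/-- The modulus of a standard complex Gaussian variable has the Rayleigh tail. -/
theorem stdGaussian_complex_norm_tail {t : ℝ} (ht : 0 ≤ t) :
    stdGaussian ℂ {z | t < ‖z‖} = ENNReal.ofReal (Real.exp (-t ^ 2 / 2)) := by
  have hm : MeasurableSet {z : ℂ | t < ‖z‖} := measurableSet_lt measurable_const measurable_norm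
  rw [stdGaussian_complex_eq_withDensity, withDensity_apply _ hm, ← lintegral_indicator hm,
    ← Complex.lintegral_comp_polarCoord_symm, polarCoord_target, Measure.volume_eq_prod,
    ← Measure.prod_restrict, lintegral_prod _ (Measurable.aemeasurable ?_)]
  -- The integrand is radial, so the angular integral is the factor 2π that cancels the normalising
  -- constant.
  · have key : ∀ r ∈ Set.Ioi (0 : ℝ), (∫⁻ θ in Set.Ioo (-Real.pi) Real.pi, ENNReal.ofReal r •
        Set.indicator {z : ℂ | t < ‖z‖}
          (fun z => ENNReal.ofReal ((2 * Real.pi)⁻¹ * Real.exp (-‖z‖ ^ 2 / 2)))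
            (Complex.polarCoord.symm (r, θ))) =
        Set.indicator (Set.Ioi t) (fun r => ENNReal.ofReal (r * Real.exp (-r ^ 2 / 2))) r := by
      intro r hr
      have hr' : (0 : ℝ) < r := hr
      by_cases h : t < r
      · simp only [Set.indicator, Set.mem_ofPred_eq, Complex.norm_polarCoord_symm, abs_of_pos hr', h,
          if_true, Set.mem_Ioi, smul_eq_mul, lintegral_const, Measure.restrict_apply_univ,
          Real.volume_Ioo]
        rw [← ENNReal.ofReal_mul hr'.le, ← ENNReal.ofReal_mul (by positivity)]
        congr 1
        have := Real.pi_pos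
        field_simp
        ring
      · simp only [Set.indicator, Set.mem_ofPred_eq, Complex.norm_polarCoord_symm, abs_of_pos hr', h,
          if_false, Set.mem_Ioi, smul_zero, lintegral_zero]
    rw [setLIntegral_congr_fun measurableSet_Ioi key, setLIntegral_indicator measurableSet_Ioi,
      Set.inter_eq_left.2 (Set.Ioi_subset_Ioi ht), lintegral_gaussian_radial_tail ht]
  · have hpc : Measurable fun p : ℝ × ℝ => Complex.polarCoord.symm p := by
      simp_rw [Complex.polarCoord_symm_apply]
      fun_prop
    have hf : Measurable (Set.indicator {z : ℂ | t < ‖z‖}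
        (fun z => ENNReal.ofReal ((2 * Real.pi)⁻¹ * Real.exp (-‖z‖ ^ 2 / 2)))) :=
      Measurable.indicator (by fun_prop) hm
    exact (ENNReal.measurable_ofReal.comp measurable_fst).mul (hf.comp hpc)

/-! ### Linear combinations of Gaussian steps: law, tails, independence -/

section LinearCombinations

variable {Ω : Type*} [MeasurableSpace Ω] {P : Measure Ω} {G : ℕ → Ω → ℂ}

/-- The joint characteristic function of the steps. Both the law of one combination and the
independence of several are read off from it. -/
theorem integral_exp_sum_inner_stdGaussian (hG_indep : iIndepFun G P)
    (hG_law : ∀ j, HasLaw (G j) (stdGaussian ℂ) P) (N : ℕ) (b : ℕ → ℂ) :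
    ∫ ω, Complex.exp (((∑ j ∈ Finset.range N, inner ℝ (G j ω) (b j) : ℝ) : ℂ) * Complex.I) ∂P =
      Complex.exp (((-(∑ j ∈ Finset.range N, ‖b j‖ ^ 2) / 2 : ℝ) : ℂ)) := by
  have hind : iIndepFun (fun (j : Fin N) => G j) P := hG_indep.precomp Fin.val_injective
  have h := hind.integral_fun_prod_comp (f := fun (j : Fin N) (z : ℂ) =>
    Complex.exp ((inner ℝ z (b j) : ℝ) * Complex.I)) (fun j => (hG_law j).aemeasurable)
    (fun j => Continuous.aestronglyMeasurable (by fun_prop))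
  have h1 : ∀ ω, Complex.exp (((∑ j ∈ Finset.range N, inner ℝ (G j ω) (b j) : ℝ) : ℂ) * Complex.I)
      = ∏ j : Fin N, Complex.exp ((inner ℝ (G j ω) (b j) : ℝ) * Complex.I) := by
    intro ω
    rw [← Complex.exp_sum, ← Finset.sum_mul, ← Complex.ofReal_sum, Finset.sum_range]
  have h2 : ∀ j : Fin N, ∫ ω, Complex.exp ((inner ℝ (G j ω) (b j) : ℝ) * Complex.I) ∂P =
      Complex.exp (((-‖b j‖ ^ 2 / 2 : ℝ) : ℂ)) := by
    intro j
    rw [← integral_map (φ := G j) (f := fun z => Complex.exp ((inner ℝ z (b j) : ℝ) * Complex.I))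
      (hG_law j).aemeasurable (Continuous.aestronglyMeasurable (by fun_prop)), (hG_law j).map_eq,
      ← charFun_apply, charFun_stdGaussian]
    push_cast
    rfl
  simp_rw [h1, h, h2]
  rw [← Complex.exp_sum, ← Complex.ofReal_sum, Finset.sum_range, ← Finset.sum_neg_distrib,
    Finset.sum_div]

theorem aemeasurable_sum_mul_gaussian (hG_law : ∀ j, HasLaw (G j) (stdGaussian ℂ) P) (N : ℕ)
    (a : ℕ → ℂ) : AEMeasurable (fun ω => ∑ j ∈ Finset.range N, a j * G j ω) P :=
  Finset.aemeasurable_fun_sum _ fun j _ => (hG_law j).aemeasurable.const_mul (a j)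

/-- The adjoint of multiplication by `a` is multiplication by its conjugate; this moves coefficients
onto the frequency. -/
theorem inner_mul_left_complex (a z w : ℂ) :
    inner ℝ (a * z) w = inner ℝ z ((starRingEnd ℂ) a * w) := by
  simp only [Complex.inner, map_mul]
  congr 1
  ring

theorem charFun_sum_mul_gaussian (hG_indep : iIndepFun G P)
    (hG_law : ∀ j, HasLaw (G j) (stdGaussian ℂ) P) (N : ℕ) (a : ℕ → ℂ) (w : ℂ) :
    charFun (P.map fun ω => ∑ j ∈ Finset.range N, a j * G j ω) w =
      Complex.exp (((-((∑ j ∈ Finset.range N, ‖a j‖ ^ 2) * ‖w‖ ^ 2) / 2 : ℝ) : ℂ)) := by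
  rw [charFun_apply, integral_map (aemeasurable_sum_mul_gaussian hG_law N a)
    (Continuous.aestronglyMeasurable (by fun_prop))]
  simp_rw [sum_inner, inner_mul_left_complex]
  rw [integral_exp_sum_inner_stdGaussian hG_indep hG_law]
  simp [Finset.sum_mul, mul_pow]

/-- A linear combination of independent standard complex Gaussian variables is, up to a scalar, a
standard complex Gaussian variable. -/
theorem map_sum_mul_gaussian (hG_indep : iIndepFun G P)
    (hG_law : ∀ j, HasLaw (G j) (stdGaussian ℂ) P) (N : ℕ) (a : ℕ → ℂ) :
    P.map (fun ω => ∑ j ∈ Finset.range N, a j * G j ω) =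
      (stdGaussian ℂ).map (fun z => √(∑ j ∈ Finset.range N, ‖a j‖ ^ 2) • z) := by
  have := hG_indep.isProbabilityMeasure
  have := Measure.isProbabilityMeasure_map (aemeasurable_sum_mul_gaussian hG_law N a)
  have : IsProbabilityMeasure ((stdGaussian ℂ).map
      (fun z => √(∑ j ∈ Finset.range N, ‖a j‖ ^ 2) • z)) :=
    Measure.isProbabilityMeasure_map (by fun_prop)
  apply Measure.ext_of_charFun
  ext w
  rw [charFun_sum_mul_gaussian hG_indep hG_law, charFun_map_smul, charFun_stdGaussian, norm_smul,
    ← Complex.ofReal_pow, mul_pow, Real.norm_eq_abs, sq_abs, Real.sq_sqrt (by positivity)]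
  push_cast
  rfl

/-- The standard deviation multiplies instead of dividing the threshold, so that degenerate
combinations are covered and monotonicity in the variance is immediate. -/
theorem measure_sum_mul_gaussian_tail (hG_indep : iIndepFun G P)
    (hG_law : ∀ j, HasLaw (G j) (stdGaussian ℂ) P) (N : ℕ) (a : ℕ → ℂ) {t : ℝ} :
    P {ω | t < ‖∑ j ∈ Finset.range N, a j * G j ω‖} =
      stdGaussian ℂ {z | t < √(∑ j ∈ Finset.range N, ‖a j‖ ^ 2) * ‖z‖} := by
  have hm : MeasurableSet {z : ℂ | t < ‖z‖} := measurableSet_lt measurable_const measurable_norm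
  have h := congrArg (fun μ : Measure ℂ => μ {z | t < ‖z‖})
    (map_sum_mul_gaussian hG_indep hG_law N a)
  rw [Measure.map_apply_of_aemeasurable (aemeasurable_sum_mul_gaussian hG_law N a) hm,
    Measure.map_apply (by fun_prop) hm] at h
  simpa [Set.preimage, norm_smul, abs_of_nonneg (Real.sqrt_nonneg _)] using h

theorem stdGaussian_complex_scaled_norm_tail {t v : ℝ} (ht : 0 ≤ t) (hv : 0 < v) :
    stdGaussian ℂ {z | t < √v * ‖z‖} = ENNReal.ofReal (Real.exp (-t ^ 2 / (2 * v))) := by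
  have h : {z : ℂ | t < √v * ‖z‖} = {z : ℂ | t / √v < ‖z‖} := by
    ext z
    simp only [Set.mem_ofPred_eq]
    rw [div_lt_iff₀' (Real.sqrt_pos.2 hv)]
  rw [h, stdGaussian_complex_norm_tail (by positivity), div_pow, Real.sq_sqrt hv.le]
  congr 2
  field_simp

theorem measure_sum_mul_gaussian_tail_le (hG_indep : iIndepFun G P)
    (hG_law : ∀ j, HasLaw (G j) (stdGaussian ℂ) P) (N : ℕ) (a : ℕ → ℂ) {t v : ℝ} (ht : 0 ≤ t)
    (hv : 0 < v) (hav : ∑ j ∈ Finset.range N, ‖a j‖ ^ 2 ≤ v) :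
    P {ω | t < ‖∑ j ∈ Finset.range N, a j * G j ω‖} ≤
      ENNReal.ofReal (Real.exp (-t ^ 2 / (2 * v))) := by
  rw [measure_sum_mul_gaussian_tail hG_indep hG_law, ← stdGaussian_complex_scaled_norm_tail ht hv]
  refine measure_mono fun z hz => ?_
  simp only [Set.mem_ofPred_eq] at hz ⊢
  refine lt_of_lt_of_le hz ?_
  gcongr

theorem measure_sum_mul_gaussian_tail_eq (hG_indep : iIndepFun G P)
    (hG_law : ∀ j, HasLaw (G j) (stdGaussian ℂ) P) (N : ℕ) (a : ℕ → ℂ) {t v : ℝ} (ht : 0 ≤ t)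
    (hv : 0 < v) (hav : ∑ j ∈ Finset.range N, ‖a j‖ ^ 2 = v) :
    P {ω | t < ‖∑ j ∈ Finset.range N, a j * G j ω‖} =
      ENNReal.ofReal (Real.exp (-t ^ 2 / (2 * v))) := by
  rw [measure_sum_mul_gaussian_tail hG_indep hG_law, hav, stdGaussian_complex_scaled_norm_tail ht hv]

/-- Pythagoras: the cross terms vanish. This is what makes the joint characteristic function of the
combinations factor. -/
theorem sum_norm_sq_of_orthogonal {M : ℕ} (N : ℕ) (c : Fin M → ℕ → ℂ)
    (hc : ∀ k l, k ≠ l → ∑ j ∈ Finset.range N, c k j * (starRingEnd ℂ) (c l j) = 0)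
    (w : Fin M → ℂ) :
    ∑ j ∈ Finset.range N, ‖∑ k, (starRingEnd ℂ) (c k j) * w k‖ ^ 2 =
      ∑ k, (∑ j ∈ Finset.range N, ‖c k j‖ ^ 2) * ‖w k‖ ^ 2 := by
  have hsq : ∀ z : ℂ, ((‖z‖ ^ 2 : ℝ) : ℂ) = (starRingEnd ℂ) z * z := fun z => by
    rw [Complex.conj_mul', Complex.ofReal_pow]
  apply Complex.ofReal_injective
  rw [Complex.ofReal_sum, Complex.ofReal_sum]
  simp_rw [Complex.ofReal_mul, Complex.ofReal_sum, hsq, map_sum, map_mul, Finset.sum_mul_sum,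
    Complex.conj_conj]
  rw [Finset.sum_comm]
  refine Finset.sum_congr rfl fun k _ => ?_
  rw [Finset.sum_comm, Finset.sum_eq_single k]
  · rw [Finset.sum_mul]
    exact Finset.sum_congr rfl fun j _ => by ring
  · intro l _ hl
    have : ∀ j, c k j * (starRingEnd ℂ) (w k) * ((starRingEnd ℂ) (c l j) * w l) =
        (c k j * (starRingEnd ℂ) (c l j)) * ((starRingEnd ℂ) (w k) * w l) := fun j => by ring
    simp_rw [this]
    rw [← Finset.sum_mul, hc k l (Ne.symm hl), zero_mul]
  · simp

/-- Linear combinations of independent standard complex Gaussian variables with pairwise orthogonal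
coefficients are independent. -/
theorem iIndepFun_sum_mul_gaussian (hG_indep : iIndepFun G P)
    (hG_law : ∀ j, HasLaw (G j) (stdGaussian ℂ) P) {M : ℕ} (N : ℕ) (c : Fin M → ℕ → ℂ)
    (hc : ∀ k l, k ≠ l → ∑ j ∈ Finset.range N, c k j * (starRingEnd ℂ) (c l j) = 0) :
    iIndepFun (fun k ω => ∑ j ∈ Finset.range N, c k j * G j ω) P := by
  have := hG_indep.isProbabilityMeasure
  have hm := fun k => aemeasurable_sum_mul_gaussian hG_law N (c k)
  rw [iIndepFun_iff_charFun_pi hm]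
  intro w
  simp_rw [charFun_sum_mul_gaussian hG_indep hG_law]
  rw [charFun_apply, integral_map (by fun_prop) (Continuous.aestronglyMeasurable (by fun_prop))]
  have h : ∀ ω, inner ℝ (WithLp.toLp 2 fun k => ∑ j ∈ Finset.range N, c k j * G j ω) w =
      ∑ j ∈ Finset.range N, inner ℝ (G j ω) (∑ k, (starRingEnd ℂ) (c k j) * w k) := by
    intro ω
    simp_rw [PiLp.inner_apply, sum_inner, inner_mul_left_complex, inner_sum]
    exact Finset.sum_comm
  simp_rw [h]
  rw [integral_exp_sum_inner_stdGaussian hG_indep hG_law, sum_norm_sq_of_orthogonal N c hc,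
    ← Complex.exp_sum, ← Complex.ofReal_sum, ← Finset.sum_neg_distrib, Finset.sum_div]

end LinearCombinations

/-! ### Cantor sets coded by binary digits -/

open scoped NNReal in
/-- A set that carries an injective image of the unit interval under a map whose inverse is
`t`-Hölder has Hausdorff dimension at least `t`. -/
theorem le_dimH_of_antiholder {S : Set ℝ} {h : ℝ → ℝ} {C t : ℝ≥0} (ht : 0 < t)
    (hS : ∀ u ∈ Set.Ico (0 : ℝ) 1, h u ∈ S)
    (hh : ∀ u ∈ Set.Ico (0 : ℝ) 1, ∀ v ∈ Set.Ico (0 : ℝ) 1, |u - v| ≤ C * |h u - h v| ^ (t : ℝ)) :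
    (t : ENNReal) ≤ dimH S := by
  have hinj : Set.InjOn h (Set.Ico 0 1) := by
    intro u hu v hv huv
    have := hh u hu v hv
    rw [huv, sub_self, abs_zero, Real.zero_rpow (by exact_mod_cast ht.ne'), mul_zero] at this
    exact sub_eq_zero.1 (abs_nonpos_iff.1 this)
  have hleft : Set.LeftInvOn (Function.invFunOn h (Set.Ico 0 1)) h (Set.Ico 0 1) :=
    hinj.leftInvOn_invFunOn
  have hhold : HolderOnWith C t (Function.invFunOn h (Set.Ico 0 1)) (h '' Set.Ico 0 1) := by
    rintro _ ⟨u, hu, rfl⟩ _ ⟨v, hv, rfl⟩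
    rw [hleft hu, hleft hv, edist_dist, edist_dist, Real.dist_eq, Real.dist_eq,
      ENNReal.ofReal_rpow_of_nonneg (abs_nonneg _) t.coe_nonneg, ← ENNReal.ofReal_coe_nnreal (p := C),
      ← ENNReal.ofReal_mul C.coe_nonneg]
    exact ENNReal.ofReal_le_ofReal (hh u hu v hv)
  have h1 := hhold.dimH_image_le ht
  rw [hleft.image_image, Real.dimH_of_nonempty_interior (by simp)] at h1
  rw [ENNReal.le_div_iff_mul_le (by simp [ht.ne']) (by simp)] at h1
  calc (t : ENNReal) = (Module.finrank ℝ ℝ : ENNReal) * t := by simp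
    _ ≤ dimH (h '' Set.Ico 0 1) := h1
    _ ≤ dimH S := dimH_mono (by rintro _ ⟨u, hu, rfl⟩; exact hS u hu)

section CantorMap

/-- The digits of `u` (blocks of `b k` binary digits) select nested dyadic cells: in the cell of
index `i` of the current level, the next block `j` selects the sub-cell `2 j`, inside which `ch`
selects a cell of the next level. The second component is the remainder of `u`. -/
noncomputable def cantorState (b : ℕ → ℕ) (ch : ℕ → ℕ → ℕ) (u : ℝ) : ℕ → ℕ × ℝ
  | 0 => (0, u)
  | k + 1 =>
    (ch k ((cantorState b ch u k).1 * 2 ^ (b k + 1) + 2 * ⌊2 ^ b k * (cantorState b ch u k).2⌋₊),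
      Int.fract (2 ^ b k * (cantorState b ch u k).2))

variable {n b e : ℕ → ℕ} {ch : ℕ → ℕ → ℕ}

theorem cantorState_snd_mem {u : ℝ} (hu : u ∈ Set.Ico (0 : ℝ) 1) (k : ℕ) :
    (cantorState b ch u k).2 ∈ Set.Ico (0 : ℝ) 1 := by
  cases k with
  | zero => exact hu
  | succ k => exact ⟨Int.fract_nonneg _, Int.fract_lt_one _⟩

/-- The block of digits that is read at stage `k`. -/
noncomputable def cantorDigit (b : ℕ → ℕ) (ch : ℕ → ℕ → ℕ) (u : ℝ) (k : ℕ) : ℕ :=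
  ⌊2 ^ b k * (cantorState b ch u k).2⌋₊

theorem cantorDigit_lt {u : ℝ} (hu : u ∈ Set.Ico (0 : ℝ) 1) (k : ℕ) :
    cantorDigit b ch u k < 2 ^ b k := by
  obtain ⟨h0, h1⟩ := cantorState_snd_mem (b := b) (ch := ch) hu k
  rw [cantorDigit, Nat.floor_lt (by positivity)]
  push_cast
  have : (0 : ℝ) < 2 ^ b k := by positivity
  nlinarith

theorem cantorState_snd_succ {u : ℝ} (hu : u ∈ Set.Ico (0 : ℝ) 1) (k : ℕ) :
    (cantorState b ch u (k + 1)).2 =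
      2 ^ b k * (cantorState b ch u k).2 - cantorDigit b ch u k := by
  obtain ⟨h0, h1⟩ := cantorState_snd_mem (b := b) (ch := ch) hu k
  rw [cantorDigit, natCast_floor_eq_intCast_floor (by positivity)]
  rfl

/-- The index of the sub-cell that is selected at stage `k`. -/
noncomputable def cantorCell (b : ℕ → ℕ) (ch : ℕ → ℕ → ℕ) (u : ℝ) (k : ℕ) : ℕ :=
  (cantorState b ch u k).1 * 2 ^ (b k + 1) + 2 * cantorDigit b ch u k

-- From level `n k` to level `n (k + 1)` there are `b k` free digits, one digit 0 that leaves a gap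
-- between selected sub-cells, and `e k` digits prescribed by `ch`, which `hch` makes a choice of
-- descendant.
variable (hn0 : n 0 = 0) (hn : ∀ k, n (k + 1) = n k + b k + 1 + e k)
  (hch : ∀ k c, c < 2 ^ (n k + b k + 1) → ch k c / 2 ^ e k = c)

include hn0 hn hch in
theorem cantorState_fst_lt {u : ℝ} (hu : u ∈ Set.Ico (0 : ℝ) 1) (k : ℕ) :
    (cantorState b ch u k).1 < 2 ^ n k ∧ cantorCell b ch u k < 2 ^ (n k + b k + 1) := by
  have step : ∀ k, (cantorState b ch u k).1 < 2 ^ n k →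
      cantorCell b ch u k < 2 ^ (n k + b k + 1) := by
    intro k hk
    have hd := cantorDigit_lt (b := b) (ch := ch) hu k
    rw [cantorCell, add_assoc, pow_add 2 (n k)]
    have h2 : 2 ^ (b k + 1) = 2 * 2 ^ b k := by ring
    nlinarith [Nat.mul_le_mul_right (2 ^ (b k + 1)) (Nat.succ_le_of_lt hk)]
  induction k with
  | zero =>
    have h0 : (cantorState b ch u 0).1 < 2 ^ n 0 := by simp [cantorState, hn0]
    exact ⟨h0, step 0 h0⟩
  | succ k ih =>
    have h1 : (cantorState b ch u (k + 1)).1 < 2 ^ n (k + 1) := by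
      have h := hch k _ ih.2
      change ch k (cantorCell b ch u k) < _
      have h2 : ch k (cantorCell b ch u k) / 2 ^ e k < 2 ^ (n k + b k + 1) := h.trans_lt ih.2
      rw [Nat.div_lt_iff_lt_mul (by positivity), ← pow_add] at h2
      rwa [hn]
    exact ⟨h1, step _ h1⟩

include hn0 hn hch in
theorem cantorState_div {u : ℝ} (hu : u ∈ Set.Ico (0 : ℝ) 1) (k : ℕ) :
    (cantorState b ch u (k + 1)).1 / 2 ^ e k = cantorCell b ch u k :=
  hch k _ (cantorState_fst_lt hn0 hn hch hu k).2

/-- The left end point of the cell of stage `k`. -/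
noncomputable def cantorPoint (n b : ℕ → ℕ) (ch : ℕ → ℕ → ℕ) (u : ℝ) (k : ℕ) : ℝ :=
  ((cantorState b ch u k).1 : ℝ) / 2 ^ n k

theorem cantorPoint_le_cell (u : ℝ) (k : ℕ) :
    cantorPoint n b ch u k ≤ (cantorCell b ch u k : ℝ) / 2 ^ (n k + b k + 1) := by
  rw [cantorPoint, cantorCell, div_le_div_iff₀ (by positivity) (by positivity), add_assoc,
    pow_add 2 (n k)]
  push_cast
  have : (0 : ℝ) ≤ 2 * (cantorDigit b ch u k) * 2 ^ n k := by positivity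
  nlinarith

/-- The gap digit 0 keeps the selected sub-cell away from the right end of its parent. Strictness
puts the limit point in the half-open dyadic cell. -/
theorem cell_add_one_lt_cantorPoint {u : ℝ} (hu : u ∈ Set.Ico (0 : ℝ) 1) (k : ℕ) :
    ((cantorCell b ch u k : ℝ) + 1) / 2 ^ (n k + b k + 1) < cantorPoint n b ch u k + 1 / 2 ^ n k := by
  have hd : (cantorDigit b ch u k : ℝ) + 1 ≤ 2 ^ b k := by
    exact_mod_cast cantorDigit_lt (b := b) (ch := ch) hu k
  rw [cantorPoint, cantorCell, ← add_div, div_lt_div_iff₀ (by positivity) (by positivity),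
    add_assoc (n k), pow_add 2 (n k)]
  push_cast
  have h2 : (2 : ℝ) ^ (b k + 1) = 2 * 2 ^ b k := by ring
  have h3 : (0 : ℝ) < 2 ^ n k := by positivity
  rw [h2]
  nlinarith [mul_le_mul_of_nonneg_right hd h3.le]

include hn0 hn hch in
theorem cell_le_cantorPoint_succ {u : ℝ} (hu : u ∈ Set.Ico (0 : ℝ) 1) (k : ℕ) :
    (cantorCell b ch u k : ℝ) / 2 ^ (n k + b k + 1) ≤ cantorPoint n b ch u (k + 1) ∧
      cantorPoint n b ch u (k + 1) + 1 / 2 ^ n (k + 1) ≤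
        ((cantorCell b ch u k : ℝ) + 1) / 2 ^ (n k + b k + 1) := by
  have h := cantorState_div hn0 hn hch hu k
  have hpos : 0 < 2 ^ e k := by positivity
  have h1 : cantorCell b ch u k * 2 ^ e k ≤ (cantorState b ch u (k + 1)).1 :=
    (Nat.le_div_iff_mul_le hpos).1 h.ge
  have h2 : (cantorState b ch u (k + 1)).1 + 1 ≤ (cantorCell b ch u k + 1) * 2 ^ e k :=
    (Nat.div_lt_iff_lt_mul hpos).1 (h.trans_lt (Nat.lt_succ_self _))
  have h1' : (cantorCell b ch u k : ℝ) * 2 ^ e k ≤ ((cantorState b ch u (k + 1)).1 : ℝ) := by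
    exact_mod_cast h1
  have h2' : ((cantorState b ch u (k + 1)).1 : ℝ) + 1 ≤
    ((cantorCell b ch u k : ℝ) + 1) * 2 ^ e k := by exact_mod_cast h2
  have h3 : (0 : ℝ) < 2 ^ (n k + b k + 1) := by positivity
  have h4 : (0 : ℝ) < 2 ^ e k := by positivity
  rw [cantorPoint, ← add_div, hn k, pow_add 2 _ (e k)]
  constructor
  · rw [div_le_div_iff₀ h3 (by positivity)]
    nlinarith
  · rw [div_le_div_iff₀ (by positivity) h3]
    nlinarith

/-- The point that is coded by the binary digits of `u`. -/
noncomputable def cantorMap (n b : ℕ → ℕ) (ch : ℕ → ℕ → ℕ) (u : ℝ) : ℝ :=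
  ⨆ k, cantorPoint n b ch u k

include hn0 hn hch in
theorem cantorMap_mem_cell {u : ℝ} (hu : u ∈ Set.Ico (0 : ℝ) 1) (k : ℕ) :
    (cantorCell b ch u k : ℝ) / 2 ^ (n k + b k + 1) ≤ cantorMap n b ch u ∧
      cantorMap n b ch u ≤ ((cantorCell b ch u k : ℝ) + 1) / 2 ^ (n k + b k + 1) := by
  have hmono : Monotone (cantorPoint n b ch u) := monotone_nat_of_le_succ fun k =>
    (cantorPoint_le_cell u k).trans (cell_le_cantorPoint_succ hn0 hn hch hu k).1
  have hanti : Antitone (fun k => cantorPoint n b ch u k + 1 / 2 ^ n k) :=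
    antitone_nat_of_succ_le fun k =>
      (cell_le_cantorPoint_succ hn0 hn hch hu k).2.trans (cell_add_one_lt_cantorPoint hu k).le
  have hub : ∀ j, cantorPoint n b ch u j ≤
      ((cantorCell b ch u k : ℝ) + 1) / 2 ^ (n k + b k + 1) := by
    intro j
    calc cantorPoint n b ch u j ≤ cantorPoint n b ch u (max j (k + 1)) := hmono (le_max_left _ _)
      _ ≤ cantorPoint n b ch u (max j (k + 1)) + 1 / 2 ^ n (max j (k + 1)) :=
        le_add_of_nonneg_right (by positivity)
      _ ≤ cantorPoint n b ch u (k + 1) + 1 / 2 ^ n (k + 1) := hanti (le_max_right _ _)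
      _ ≤ _ := (cell_le_cantorPoint_succ hn0 hn hch hu k).2
  exact ⟨(cell_le_cantorPoint_succ hn0 hn hch hu k).1.trans
    (le_ciSup ⟨_, Set.forall_mem_range.2 hub⟩ (k + 1)), ciSup_le hub⟩

include hn0 hn hch in
theorem cantorMap_mem_dyadicInterval {u : ℝ} (hu : u ∈ Set.Ico (0 : ℝ) 1) (k : ℕ) :
    cantorMap n b ch u ∈ dyadicInterval (n k) (cantorState b ch u k).1 := by
  obtain ⟨h1, h2⟩ := cantorMap_mem_cell hn0 hn hch hu k
  refine ⟨(cantorPoint_le_cell u k).trans h1, h2.trans_lt ?_⟩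
  have := cell_add_one_lt_cantorPoint (n := n) (b := b) (ch := ch) hu k
  rwa [cantorPoint, ← add_div] at this

include hn0 hn hch in
theorem cantorMap_mem_Ico {u : ℝ} (hu : u ∈ Set.Ico (0 : ℝ) 1) :
    cantorMap n b ch u ∈ Set.Ico (0 : ℝ) 1 := by
  simpa [dyadicInterval, hn0, cantorState] using cantorMap_mem_dyadicInterval hn0 hn hch hu 0

include hn0 hn hch in
theorem dyadicIndex_cantorMap {u : ℝ} (hu : u ∈ Set.Ico (0 : ℝ) 1) (k : ℕ) :
    dyadicIndex (n k) (cantorMap n b ch u) = (cantorState b ch u k).1 :=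
  (mem_dyadicInterval_iff (cantorMap_mem_Ico hn0 hn hch hu).1).1
    (cantorMap_mem_dyadicInterval hn0 hn hch hu k)

theorem cantorCell_inj {u v : ℝ} (hu : u ∈ Set.Ico (0 : ℝ) 1) (hv : v ∈ Set.Ico (0 : ℝ) 1) {k : ℕ}
    (h : cantorCell b ch u k = cantorCell b ch v k) :
    (cantorState b ch u k).1 = (cantorState b ch v k).1 ∧
      cantorDigit b ch u k = cantorDigit b ch v k := by
  have hdu := cantorDigit_lt (b := b) (ch := ch) hu k
  have hdv := cantorDigit_lt (b := b) (ch := ch) hv k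
  have h2 : 2 ^ (b k + 1) = 2 * 2 ^ b k := by ring
  simp only [cantorCell] at h
  have hpos : 0 < 2 ^ (b k + 1) := by positivity
  have h1 : (cantorState b ch u k).1 = (cantorState b ch v k).1 := by
    have := congrArg (· / 2 ^ (b k + 1)) h
    simp only [mul_comm _ (2 ^ (b k + 1)), Nat.mul_add_div hpos] at this
    rwa [Nat.div_eq_of_lt (by omega), Nat.div_eq_of_lt (by omega), add_zero, add_zero] at this
  refine ⟨h1, ?_⟩
  rw [h1] at h
  omega

-- As long as the two paths agree, the same digits are removed from `u` and `v`, so the remainders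
-- only get rescaled.
include hn0 hn hch in
theorem cantorState_snd_sub {u v : ℝ} (hu : u ∈ Set.Ico (0 : ℝ) 1) (hv : v ∈ Set.Ico (0 : ℝ) 1)
    (k : ℕ) (h : (cantorState b ch u k).1 = (cantorState b ch v k).1) :
    (cantorState b ch u k).2 - (cantorState b ch v k).2 =
      2 ^ (∑ j ∈ Finset.range k, b j) * (u - v) := by
  induction k with
  | zero => simp [cantorState]
  | succ k ih =>
    have hc : cantorCell b ch u k = cantorCell b ch v k := by
      rw [← cantorState_div hn0 hn hch hu k, ← cantorState_div hn0 hn hch hv k, h]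
    obtain ⟨h1, h2⟩ := cantorCell_inj hu hv hc
    rw [cantorState_snd_succ hu, cantorState_snd_succ hv, h2, Finset.sum_range_succ, pow_add,
      mul_right_comm, ← ih h1]
    ring

/-- Remainders differ by less than 1, whereas along a common path their difference is multiplied by
an unbounded power of 2. Hence the paths split, and at the last common cell the digits differ. -/
theorem exists_cantorState_ne {u v : ℝ} (hu : u ∈ Set.Ico (0 : ℝ) 1) (hv : v ∈ Set.Ico (0 : ℝ) 1)
    (hn0 : n 0 = 0) (hn : ∀ k, n (k + 1) = n k + b k + 1 + e k)
    (hch : ∀ k c, c < 2 ^ (n k + b k + 1) → ch k c / 2 ^ e k = c)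
    (hb : Tendsto (fun k => ∑ j ∈ Finset.range k, b j) atTop atTop) (huv : u ≠ v) :
    ∃ k, (cantorState b ch u k).1 = (cantorState b ch v k).1 ∧
      cantorDigit b ch u k ≠ cantorDigit b ch v k := by
  have hex : ∃ k, (cantorState b ch u k).1 ≠ (cantorState b ch v k).1 := by
    by_contra! hall
    have hlim : Tendsto (fun k => (2 : ℝ) ^ (∑ j ∈ Finset.range k, b j) * |u - v|) atTop atTop :=
      ((tendsto_pow_atTop_atTop_of_one_lt one_lt_two).comp hb).atTop_mul_const
        (abs_pos.2 (sub_ne_zero.2 huv))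
    obtain ⟨k, hk⟩ := (hlim.eventually_ge_atTop 1).exists
    have h := congrArg abs (cantorState_snd_sub hn0 hn hch hu hv k (hall k))
    rw [abs_mul, abs_of_pos (by positivity : (0 : ℝ) < 2 ^ (∑ j ∈ Finset.range k, b j))] at h
    obtain ⟨h1, h2⟩ := cantorState_snd_mem (b := b) (ch := ch) hu k
    obtain ⟨h3, h4⟩ := cantorState_snd_mem (b := b) (ch := ch) hv k
    have : |(cantorState b ch u k).2 - (cantorState b ch v k).2| < 1 :=
      abs_sub_lt_iff.2 ⟨by linarith, by linarith⟩
    linarith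
  classical
  obtain ⟨k, hk⟩ : ∃ k, Nat.find hex = k + 1 :=
    Nat.exists_eq_succ_of_ne_zero fun h0 => Nat.find_spec hex (by rw [h0]; rfl)
  have heq : (cantorState b ch u k).1 = (cantorState b ch v k).1 :=
    not_not.1 (Nat.find_min hex (by omega))
  refine ⟨k, heq, fun hd => Nat.find_spec hex ?_⟩
  rw [hk]
  change ch k (cantorCell b ch u k) = ch k (cantorCell b ch v k)
  rw [cantorCell, cantorCell, heq, hd]

-- Let `k` be the last common stage, `d` the difference of the digits there and x = d / 2 ^ b k ≤ 1.
-- The images are at least x 2^(-n k - 1) apart, while |u - v| is at most 2x times the inverse of 2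
-- to the number of digits already read. Then x ≤ x^t and `hM` compare the two.
include hn0 hn hch in
theorem abs_sub_le_cantorMap {t : ℝ} (ht0 : 0 < t) (ht1 : t ≤ 1)
    (hb : Tendsto (fun k => ∑ j ∈ Finset.range k, b j) atTop atTop)
    (hM : ∀ k, t * n k ≤ (∑ j ∈ Finset.range k, b j : ℕ))
    {u v : ℝ} (hu : u ∈ Set.Ico (0 : ℝ) 1) (hv : v ∈ Set.Ico (0 : ℝ) 1) :
    |u - v| ≤ 4 * |cantorMap n b ch u - cantorMap n b ch v| ^ t := by
  rcases eq_or_ne u v with rfl | huv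
  · simp only [sub_self, abs_zero]
    positivity
  obtain ⟨k, hk, hd⟩ := exists_cantorState_ne hu hv hn0 hn hch hb huv
  wlog hlt : cantorDigit b ch v k < cantorDigit b ch u k generalizing u v
  · rw [abs_sub_comm, abs_sub_comm (cantorMap n b ch u)]
    exact this hv hu huv.symm hk.symm hd.symm (lt_of_le_of_ne (not_lt.1 hlt) hd)
  set d : ℝ := (cantorDigit b ch u k : ℝ) - cantorDigit b ch v k with hd_def
  have hd1 : 1 ≤ d := by
    have : (cantorDigit b ch v k : ℝ) + 1 ≤ cantorDigit b ch u k := by exact_mod_cast hlt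
    linarith
  have hdb : d ≤ 2 ^ b k := by
    have h1 : (cantorDigit b ch u k : ℝ) ≤ 2 ^ b k := by
      exact_mod_cast (cantorDigit_lt (b := b) (ch := ch) hu k).le
    have h2 : (0 : ℝ) ≤ cantorDigit b ch v k := by positivity
    linarith
  set x : ℝ := d / 2 ^ b k with hx
  have hx0 : 0 < x := by positivity
  have hx1 : x ≤ 1 := (div_le_one (by positivity)).2 hdb
  have hlow : x * (2 ^ (n k + 1))⁻¹ ≤ |cantorMap n b ch u - cantorMap n b ch v| := by
    refine le_trans ?_ (le_abs_self _)
    have h1 := (cantorMap_mem_cell hn0 hn hch hu k).1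
    have h2 := (cantorMap_mem_cell hn0 hn hch hv k).2
    refine le_trans ?_ (sub_le_sub h1 h2)
    -- Sub-cells have even index, so the gap between them is `2 * d - 1 ≥ d` sub-cell lengths.
    rw [← sub_div, cantorCell, cantorCell, hk, le_div_iff₀ (by positivity), hx]
    push_cast
    have h3 : d / 2 ^ b k * (2 ^ (n k + 1))⁻¹ * 2 ^ (n k + b k + 1) = d := by
      rw [show n k + b k + 1 = b k + (n k + 1) by ring, pow_add 2 (b k)]
      field_simp
    rw [h3]
    linarith
  have hup : |u - v| * 2 ^ (∑ j ∈ Finset.range k, b j) ≤ 2 * x := by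
    have h := cantorState_snd_sub hn0 hn hch hu hv k hk
    have h1 := cantorState_snd_succ (b := b) (ch := ch) hu k
    have h2 := cantorState_snd_succ (b := b) (ch := ch) hv k
    obtain ⟨h3, h4⟩ := cantorState_snd_mem (b := b) (ch := ch) hu (k + 1)
    obtain ⟨h5, h6⟩ := cantorState_snd_mem (b := b) (ch := ch) hv (k + 1)
    have hB : (0 : ℝ) < 2 ^ b k := by positivity
    have hS : (0 : ℝ) < 2 ^ (∑ j ∈ Finset.range k, b j) := by positivity
    rw [← abs_of_pos hS, ← abs_mul, mul_comm (u - v), ← h, hx, ← mul_div_assoc, le_div_iff₀ hB,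
      ← abs_of_pos hB, ← abs_mul]
    have h7 : ((cantorState b ch u k).2 - (cantorState b ch v k).2) * 2 ^ b k =
        d + ((cantorState b ch u (k + 1)).2 - (cantorState b ch v (k + 1)).2) := by
      rw [h1, h2, hd_def]; ring
    rw [h7, abs_le]
    constructor <;> linarith
  -- The factor 2 pays for the extra 1 in the exponent `n k + 1`, as `t ≤ 1`.
  have hM' : ((2 : ℝ) ^ (∑ j ∈ Finset.range k, b j))⁻¹ ≤ 2 * ((2 ^ (n k + 1))⁻¹) ^ t := by
    rw [← Real.rpow_natCast 2 (n k + 1), ← Real.rpow_neg two_pos.le, ← Real.rpow_mul two_pos.le,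
      ← Real.rpow_natCast, ← Real.rpow_neg two_pos.le]
    nth_rewrite 2 [← Real.rpow_one 2]
    rw [← Real.rpow_add two_pos]
    refine Real.rpow_le_rpow_of_exponent_le one_le_two ?_
    have := hM k
    push_cast at this ⊢
    nlinarith
  have hS : (0 : ℝ) < 2 ^ (∑ j ∈ Finset.range k, b j) := by positivity
  calc |u - v| ≤ 2 * x * (2 ^ (∑ j ∈ Finset.range k, b j))⁻¹ := by
        rw [← div_eq_mul_inv, le_div_iff₀ hS]; exact hup
    _ ≤ 2 * x ^ t * (2 * ((2 ^ (n k + 1))⁻¹) ^ t) := by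
        gcongr
        exact Real.self_le_rpow_of_le_one hx0.le hx1 ht1
    _ = 4 * (x * (2 ^ (n k + 1))⁻¹) ^ t := by
        rw [Real.mul_rpow hx0.le (by positivity)]; ring
    _ ≤ _ := by gcongr

end CantorMap

/-! ### Dimension of upper limits of dyadic cells -/

/-- If for infinitely many `n` every dyadic cell of level `⌊s n⌋` contains a cell of `E n`, a set of
dyadic cells of level `n`, then the upper limit of the sets `E n` has dimension at least `s`. -/
theorem le_dimH_limsup_dyadic {E : ℕ → Set ℕ} {s : ℝ} (hs0 : 0 < s) (hs1 : s ≤ 1)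
    (hE : ∃ᶠ n : ℕ in atTop, ∀ c < 2 ^ ⌊s * n⌋₊, ∃ i ∈ E n, i / 2 ^ (n - ⌊s * n⌋₊) = c) :
    ENNReal.ofReal s ≤
      dimH {θ | θ ∈ Set.Ico (0 : ℝ) 1 ∧ ∃ᶠ n : ℕ in atTop, dyadicIndex n θ ∈ E n} := by
  refine le_of_forall_lt fun r hr => ?_
  have hr' : r ≠ ⊤ := (hr.trans ENNReal.ofReal_lt_top).ne
  lift r to NNReal using hr'
  obtain ⟨t, hrt, hts⟩ := exists_between hr
  lift t to NNReal using (hts.trans ENNReal.ofReal_lt_top).ne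
  refine hrt.trans_le ?_
  have ht0 : 0 < t := zero_le.trans_lt (by exact_mod_cast hrt)
  have hts' : (t : ℝ) < s := by
    rw [← ENNReal.ofReal_coe_nnreal, ENNReal.ofReal_lt_ofReal_iff hs0] at hts
    exact hts
  -- The next level is so far beyond the current level `a` that the digits of this one block already
  -- number at least `t * n`. The 2 pays for the floor and for the gap digit.
  have hnext : ∀ a : ℕ, ∃ n : ℕ, (∀ c < 2 ^ ⌊s * n⌋₊, ∃ i ∈ E n, i / 2 ^ (n - ⌊s * n⌋₊) = c) ∧
      (a : ℝ) + 2 ≤ (s - t) * n := by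
    intro a
    have : ∀ᶠ n : ℕ in atTop, (a : ℝ) + 2 ≤ (s - t) * n :=
      (tendsto_natCast_atTop_atTop.const_mul_atTop (sub_pos.2 hts')).eventually_ge_atTop _
    exact (hE.and_eventually this).exists
  choose f hf1 hf2 using hnext
  choose! pick hpick1 hpick2 using hf1
  let n : ℕ → ℕ := fun k => f^[k] 0
  have hn0 : n 0 = 0 := rfl
  have hn1 : ∀ k, n (k + 1) = f (n k) := fun k => Function.iterate_succ_apply' f k 0
  have hm1 : ∀ k, (n k : ℝ) + 1 + t * n (k + 1) ≤ ⌊s * n (k + 1)⌋₊ := by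
    intro k
    have h1 := hf2 (n k)
    rw [← hn1] at h1
    have h2 := Nat.sub_one_lt_floor (s * n (k + 1))
    linarith
  have hm2 : ∀ k, ⌊s * n (k + 1)⌋₊ ≤ n (k + 1) := fun k =>
    Nat.floor_le_of_le (mul_le_of_le_one_left (by positivity) hs1)
  have hm3 : ∀ k, n k + 1 ≤ ⌊s * n (k + 1)⌋₊ := by
    intro k
    have : (0 : ℝ) ≤ t * n (k + 1) := by positivity
    exact_mod_cast (le_add_of_nonneg_right this).trans (hm1 k)
  let b : ℕ → ℕ := fun k => ⌊s * n (k + 1)⌋₊ - n k - 1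
  have hb : ∀ k, n k + b k + 1 = ⌊s * n (k + 1)⌋₊ := fun k => by
    have := hm3 k
    simp only [b]
    omega
  let e : ℕ → ℕ := fun k => n (k + 1) - ⌊s * n (k + 1)⌋₊
  have hn : ∀ k, n (k + 1) = n k + b k + 1 + e k := fun k => by
    have := hm2 k
    rw [hb]
    simp only [e]
    omega
  let ch : ℕ → ℕ → ℕ := fun k c => pick (n k) c
  have hch : ∀ k c, c < 2 ^ (n k + b k + 1) → ch k c / 2 ^ e k = c := by
    intro k c hc
    rw [hb, hn1] at hc
    simp only [ch, e, hn1]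
    exact hpick2 _ _ hc
  have hM : ∀ k, (t : ℝ) * n k ≤ (∑ j ∈ Finset.range k, b j : ℕ) := by
    intro k
    cases k with
    | zero => simp [hn0]
    | succ k =>
      have h1 : ((b k : ℕ) : ℝ) ≤ (∑ j ∈ Finset.range (k + 1), b j : ℕ) := by
        exact_mod_cast Finset.single_le_sum (f := b) (fun _ _ => Nat.zero_le _)
          (Finset.self_mem_range_succ k)
      have h2 : ((n k + b k + 1 : ℕ) : ℝ) = ⌊s * n (k + 1)⌋₊ := by exact_mod_cast hb k
      push_cast at h2
      have := hm1 k
      linarith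
  have hmono : StrictMono n := strictMono_nat_of_lt_succ fun k => by rw [hn k]; omega
  have hbt : Tendsto (fun k => ∑ j ∈ Finset.range k, b j) atTop atTop := by
    rw [← tendsto_natCast_atTop_iff (R := ℝ)]
    refine tendsto_atTop_mono hM ?_
    exact (tendsto_natCast_atTop_atTop.comp hmono.tendsto_atTop).const_mul_atTop
      (by exact_mod_cast ht0)
  refine le_dimH_of_antiholder (h := cantorMap n b ch) (C := 4) ht0 (fun u hu => ?_)
    fun u hu v hv => ?_
  · refine ⟨cantorMap_mem_Ico hn0 hn hch hu, ?_⟩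
    rw [frequently_atTop]
    intro a
    refine ⟨n (a + 1), (Nat.le_succ a).trans hmono.le_apply, ?_⟩
    rw [dyadicIndex_cantorMap hn0 hn hch hu]
    have h1 := (cantorState_fst_lt hn0 hn hch hu a).2
    rw [hb, hn1] at h1
    have h2 := hpick1 _ _ h1
    rw [hn1]
    exact h2
  · exact abs_sub_le_cantorMap hn0 hn hch (by exact_mod_cast ht0) (hts'.le.trans hs1) hbt hM hu hv

theorem ediam_dyadicInterval_le (n i : ℕ) :
    Metric.ediam (dyadicInterval n i) ≤ ENNReal.ofReal (1 / 2 ^ n) := by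
  rw [dyadicInterval, Real.ediam_Ico, ← sub_div, add_sub_cancel_left]

theorem dyadicIndex_lt {n : ℕ} {θ : ℝ} (hθ : θ ∈ Set.Ico (0 : ℝ) 1) : dyadicIndex n θ < 2 ^ n := by
  have h : (0 : ℝ) < 2 ^ n := by positivity
  rw [dyadicIndex, Nat.floor_lt (mul_nonneg h.le hθ.1)]
  push_cast
  nlinarith [hθ.2]

theorem dyadicIndex_div {m n : ℕ} (hmn : m ≤ n) (θ : ℝ) :
    dyadicIndex n θ / 2 ^ (n - m) = dyadicIndex m θ := by
  rw [dyadicIndex, dyadicIndex, ← Nat.floor_div_natCast]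
  congr 1
  push_cast
  rw [pow_sub₀ 2 two_ne_zero hmn]
  have : (0 : ℝ) < 2 ^ n := by positivity
  field_simp

open scoped Topology in
/-- An upper limit of collections `F n` of dyadic cells of level `m n` has dimension at most `s` if
the sum of the `s`-th powers of the lengths of all the cells is finite. -/
theorem dimH_limsup_dyadic_le {m : ℕ → ℕ} (hm : Monotone m) (hm' : Tendsto m atTop atTop)
    {F : ℕ → Set ℕ} {s : ℝ} (hs : 0 ≤ s)
    (hF : ∑' n, ∑' c, (F n).indicator (fun _ => ENNReal.ofReal (1 / 2 ^ m n) ^ s) c ≠ ⊤) {S : Set ℝ}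
    (hS : ∀ θ ∈ S, 0 ≤ θ ∧ ∃ᶠ n : ℕ in atTop, dyadicIndex (m n) θ ∈ F n) :
    dimH S ≤ ENNReal.ofReal s := by
  have hr : Tendsto (fun n => ENNReal.ofReal (1 / 2 ^ m n)) atTop (𝓝 0) := by
    rw [← ENNReal.ofReal_zero]
    refine ENNReal.tendsto_ofReal ?_
    simp_rw [one_div, ← inv_pow]
    exact (tendsto_pow_atTop_nhds_zero_of_lt_one (by norm_num) (by norm_num)).comp hm'
  -- The n-th cover consists of all cells of the collections from index `n` on. Its sum is a tail of
  -- the convergent series, so the `s`-dimensional measure is 0.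
  have hle := Measure.hausdorffMeasure_le_liminf_tsum (X := ℝ) (ι := fun n => {p : ℕ × ℕ // p.2 ∈ F (p.1 + n)})
    s S (l := atTop) (fun n => ENNReal.ofReal (1 / 2 ^ m n)) hr
    (fun n p => dyadicInterval (m (p.1.1 + n)) p.1.2)
    (Eventually.of_forall fun n p => (ediam_dyadicInterval_le _ _).trans ?_)
    (Eventually.of_forall fun n θ hθ => ?_)
  · have hsum : ∀ n : ℕ, ∑' p : {p : ℕ × ℕ // p.2 ∈ F (p.1 + n)},
        Metric.ediam (dyadicInterval (m (p.1.1 + n)) p.1.2) ^ s ≤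
        ∑' k, ∑' c, (F (k + n)).indicator (fun _ => ENNReal.ofReal (1 / 2 ^ m (k + n)) ^ s) c := by
      intro n
      rw [← ENNReal.tsum_prod (f := fun k c => (F (k + n)).indicator
        (fun _ => ENNReal.ofReal (1 / 2 ^ m (k + n)) ^ s) c)]
      calc _ ≤ ∑' p : {p : ℕ × ℕ // p.2 ∈ F (p.1 + n)},
            ENNReal.ofReal (1 / 2 ^ m (p.1.1 + n)) ^ s := by
            gcongr
            exact ediam_dyadicInterval_le _ _
        _ = ∑' p : ℕ × ℕ, Set.indicator {p : ℕ × ℕ | p.2 ∈ F (p.1 + n)}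
            (fun p => ENNReal.ofReal (1 / 2 ^ m (p.1 + n)) ^ s) p :=
          tsum_subtype {p : ℕ × ℕ | p.2 ∈ F (p.1 + n)}
            (fun p : ℕ × ℕ => ENNReal.ofReal (1 / 2 ^ m (p.1 + n)) ^ s)
        _ ≤ _ := ENNReal.tsum_le_tsum fun p => by
          simp only [Set.indicator, Set.mem_ofPred_eq, le_refl]
    have htail := ENNReal.tendsto_sum_nat_add
      (fun n => ∑' c, (F n).indicator (fun _ => ENNReal.ofReal (1 / 2 ^ m n) ^ s) c) hF
    have h0 : μH[s] S = 0 := by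
      refine le_antisymm (hle.trans ?_) zero_le
      rw [← htail.liminf_eq]
      exact liminf_le_liminf (Eventually.of_forall hsum)
    have := dimH_le_of_hausdorffMeasure_ne_top (d := s.toNNReal) (s := S)
      (by rw [Real.coe_toNNReal _ hs, h0]; exact ENNReal.zero_ne_top)
    exact this
  · exact ENNReal.ofReal_le_ofReal (one_div_le_one_div_of_le (by positivity)
      (pow_le_pow_right₀ one_le_two (hm (Nat.le_add_left _ _))))
  · obtain ⟨h0, hfr⟩ := hS θ hθ
    obtain ⟨k, hk, hkF⟩ := frequently_atTop.1 hfr n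
    refine Set.mem_iUnion.2 ⟨⟨(k - n, dyadicIndex (m k) θ), ?_⟩, ?_⟩
    · simpa [Nat.sub_add_cancel hk] using hkF
    · simp only [Nat.sub_add_cancel hk]
      exact (mem_dyadicInterval_iff h0).2 rfl

/-! ### Almost sure finiteness, growth estimates and the threshold -/

/-- A sum with finite expectation is almost surely finite. The events need not be measurable (the
steps are only almost everywhere measurable), hence the measurable hulls. -/
theorem ae_tsum_indicator_ne_top {Ω : Type*} [MeasurableSpace Ω] {P : Measure Ω}
    {A : ℕ → ℕ → Set Ω} {w : ℕ → ENNReal} (h : ∑' n, ∑' c, w n * P (A n c) ≠ ⊤) :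
    ∀ᵐ ω ∂P, ∑' n, ∑' c, (A n c).indicator (fun _ => w n) ω ≠ ⊤ := by
  have hmeas : ∀ n c, Measurable ((toMeasurable P (A n c)).indicator fun _ : Ω => w n) :=
    fun n c => measurable_const.indicator (measurableSet_toMeasurable _ _)
  have hint : ∫⁻ ω, ∑' n, ∑' c, (toMeasurable P (A n c)).indicator (fun _ => w n) ω ∂P ≠ ⊤ := by
    rw [lintegral_tsum fun n => (Measurable.tsum (hmeas n)).aemeasurable]
    convert h using 4 with n
    rw [lintegral_tsum fun c => (hmeas n c).aemeasurable]
    congr 1 with c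
    rw [lintegral_indicator_const (measurableSet_toMeasurable _ _), measure_toMeasurable]
  have hm : Measurable fun ω => ∑' n, ∑' c, (toMeasurable P (A n c)).indicator (fun _ => w n) ω :=
    Measurable.tsum fun n => Measurable.tsum (hmeas n)
  filter_upwards [ae_lt_top hm hint] with ω hω
  refine ne_top_of_le_ne_top hω.ne ?_
  refine ENNReal.tsum_le_tsum fun n => ENNReal.tsum_le_tsum fun c => ?_
  exact Set.indicator_le_indicator_of_subset (subset_toMeasurable _ _) (fun _ => zero_le) _

/-- Exponential growth is beaten by the exponential of exponential growth. -/
theorem summable_pow_mul_exp_neg_pow {A c ρ : ℝ} (hA : 0 ≤ A) (hc : 0 < c) (hρ : 1 < ρ) :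
    Summable fun n : ℕ => A ^ n * Real.exp (-(c * ρ ^ n)) := by
  -- With ρ^k ≥ 2A, the factor A^n is at most 2^(-n) (ρ^n)^k, and x^k exp(-x) absorbs the second
  -- factor.
  obtain ⟨k, hk⟩ := (tendsto_pow_atTop_atTop_of_one_lt hρ).eventually_ge_atTop (2 * A) |>.exists
  have hx : Tendsto (fun n : ℕ => c * ρ ^ n) atTop atTop :=
    (tendsto_pow_atTop_atTop_of_one_lt hρ).const_mul_atTop hc
  have hlim := (Real.tendsto_pow_mul_exp_neg_atTop_nhds_zero k).comp hx
  have hev : ∀ᶠ n : ℕ in atTop, (c * ρ ^ n) ^ k * Real.exp (-(c * ρ ^ n)) ≤ 1 :=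
    hlim.eventually_le_const zero_lt_one
  have hgeo : Summable fun n : ℕ => (c ^ k)⁻¹ * (1 / 2 : ℝ) ^ n :=
    (summable_geometric_of_lt_one (by norm_num) (by norm_num)).mul_left _
  refine hgeo.of_norm_bounded_eventually_nat ?_
  filter_upwards [hev] with n hn
  have hρ0 : 0 < ρ := by linarith
  rw [Real.norm_of_nonneg (by positivity)]
  have h1 : A ^ n ≤ (1 / 2) ^ n * (ρ ^ n) ^ k := by
    rw [← pow_mul, mul_comm n k, pow_mul, ← mul_pow]
    exact pow_le_pow_left₀ hA (by linarith) n
  calc A ^ n * Real.exp (-(c * ρ ^ n))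
      ≤ ((1 / 2) ^ n * (ρ ^ n) ^ k) * Real.exp (-(c * ρ ^ n)) := by gcongr
    _ = (c ^ k)⁻¹ * (1 / 2) ^ n * ((c * ρ ^ n) ^ k * Real.exp (-(c * ρ ^ n))) := by
        rw [mul_pow]; field_simp
    _ ≤ (c ^ k)⁻¹ * (1 / 2) ^ n * 1 := by gcongr
    _ = _ := mul_one _

theorem tendsto_natFloor_pow {q : ℝ} (hq : 1 < q) :
    Tendsto (fun n : ℕ => ⌊q ^ n⌋₊) atTop atTop :=
  tendsto_nat_floor_atTop.comp (tendsto_pow_atTop_atTop_of_one_lt hq)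

theorem natFloor_pow_le {q : ℝ} (hq : 1 < q) (n : ℕ) : ((⌊q ^ n⌋₊ : ℕ) : ℝ) ≤ q ^ n :=
  Nat.floor_le (by positivity)

theorem half_pow_le_natFloor {q : ℝ} (hq : 1 < q) (n : ℕ) : q ^ n / 2 ≤ ((⌊q ^ n⌋₊ : ℕ) : ℝ) := by
  have h1 : (1 : ℝ) ≤ ((⌊q ^ n⌋₊ : ℕ) : ℝ) := by
    exact_mod_cast Nat.le_floor (by exact_mod_cast one_le_pow₀ hq.le)
  have h2 := Nat.lt_floor_add_one (q ^ n)
  linarith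

theorem tendsto_log_natCast : Tendsto (fun N : ℕ => Real.log N) atTop atTop :=
  Real.tendsto_log_atTop.comp tendsto_natCast_atTop_atTop

theorem eventually_sqrt_add_one_le {a b : ℝ} (ha : 0 ≤ a) (hab : a < b) :
    ∀ᶠ x : ℝ in atTop, √(2 * a * x) + 1 ≤ √(2 * b * x) := by
  have hs : √(2 * a) < √(2 * b) := Real.sqrt_lt_sqrt (by positivity) (by linarith)
  have h := Real.tendsto_sqrt_atTop.const_mul_atTop (sub_pos.2 hs)
  filter_upwards [h.eventually_ge_atTop 1, eventually_ge_atTop 0] with x hx hx0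
  rw [Real.sqrt_mul (x := 2 * a) (by positivity), Real.sqrt_mul (x := 2 * b) (by linarith)]
  linarith

/-- A relative perturbation of `√N` is absorbed by a change of the parameter of the threshold. -/
theorem eventually_threshold_add_sqrt_le {a b : ℝ} (ha : 0 ≤ a) (hab : a < b) :
    ∀ᶠ N : ℕ in atTop, threshold a N + √N ≤ threshold b N := by
  filter_upwards [tendsto_log_natCast.eventually (eventually_sqrt_add_one_le ha hab)] with N hN
  have h : ∀ c : ℝ, threshold c N = √N * √(2 * c * Real.log N) := fun c => by
    rw [threshold, ← Real.sqrt_mul (by positivity)]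
    congr 1
    ring
  rw [h, h]
  nlinarith [Real.sqrt_nonneg (N : ℝ)]

theorem threshold_nonneg (a : ℝ) (N : ℕ) : 0 ≤ threshold a N := Real.sqrt_nonneg _

theorem threshold_sq {a : ℝ} (ha : 0 ≤ a) (N : ℕ) :
    threshold a N ^ 2 = 2 * a * N * Real.log N := by
  rw [threshold, Real.sq_sqrt]
  have := Real.log_natCast_nonneg N
  positivity

/-! ### Characters and their orthogonality -/

/-- The coefficient `e^{2iπ(j+1)θ}` of the step `g j` in the walk. -/
noncomputable def walkCoef (θ : ℝ) (j : ℕ) : ℂ :=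
  Complex.exp (2 * (Real.pi : ℂ) * Complex.I * ((j : ℂ) + 1) * (θ : ℂ))

theorem walk_eq (g : ℕ → ℂ) (n : ℕ) (θ : ℝ) :
    walk g n θ = ∑ j ∈ Finset.range n, walkCoef θ j * g j :=
  Finset.sum_congr rfl fun _ _ => mul_comm _ _

theorem walkCoef_eq (θ : ℝ) (j : ℕ) :
    walkCoef θ j = Complex.exp (Complex.I * ((2 * Real.pi * (j + 1) * θ : ℝ) : ℂ)) := by
  rw [walkCoef]
  congr 1
  push_cast
  ring

theorem norm_walkCoef (θ : ℝ) (j : ℕ) : ‖walkCoef θ j‖ = 1 := by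
  rw [walkCoef_eq, Complex.norm_exp_I_mul_ofReal]

theorem norm_walkCoef_sub_le (x y : ℝ) (j : ℕ) :
    ‖walkCoef x j - walkCoef y j‖ ≤ 2 * Real.pi * (j + 1) * |x - y| := by
  have h : walkCoef x j - walkCoef y j = walkCoef y j * (walkCoef (x - y) j - 1) := by
    rw [mul_sub, mul_one, walkCoef, walkCoef, walkCoef, ← Complex.exp_add]
    congr 2
    push_cast
    ring
  rw [h, norm_mul, norm_walkCoef, one_mul, walkCoef_eq]
  refine (Real.norm_exp_I_mul_ofReal_sub_one_le).trans ?_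
  rw [Real.norm_eq_abs, abs_mul, abs_of_nonneg (by positivity)]

theorem walkCoef_mul_conj (x y : ℝ) (j : ℕ) :
    walkCoef x j * (starRingEnd ℂ) (walkCoef y j) = walkCoef (x - y) j := by
  rw [walkCoef_eq y, ← Complex.exp_conj, map_mul, Complex.conj_I, Complex.conj_ofReal, walkCoef_eq,
    walkCoef_eq, ← Complex.exp_add]
  congr 1
  push_cast
  ring

/-- The products are powers of an M-th root of unity ζ, which differs from 1 because k ≠ l. As M
divides N, ζ^N = 1 and the geometric sum vanishes. -/
theorem sum_walkCoef_mul_conj {M N : ℕ} (hMN : M ∣ N) {k l : Fin M} (hkl : k ≠ l) :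
    ∑ j ∈ Finset.range N,
      walkCoef ((k : ℕ) / (M : ℝ)) j * (starRingEnd ℂ) (walkCoef ((l : ℕ) / (M : ℝ)) j) = 0 := by
  have hM : M ≠ 0 := fun h => by subst h; exact k.elim0
  have hM' : (M : ℂ) ≠ 0 := by exact_mod_cast hM
  set ζ : ℂ := Complex.exp (2 * Real.pi * Complex.I * ((((k : ℕ) : ℂ) - (l : ℕ)) / M)) with hζ
  have hterm : ∀ j, walkCoef ((k : ℕ) / (M : ℝ)) j *
      (starRingEnd ℂ) (walkCoef ((l : ℕ) / (M : ℝ)) j) = ζ * ζ ^ j := by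
    intro j
    rw [walkCoef_mul_conj, walkCoef, hζ, ← pow_succ', ← Complex.exp_nat_mul]
    congr 1
    push_cast
    ring
  have hpow : ζ ^ N = 1 := by
    obtain ⟨a, rfl⟩ := hMN
    rw [hζ, ← Complex.exp_nat_mul, Complex.exp_eq_one_iff]
    refine ⟨a * ((k : ℕ) - (l : ℕ)), ?_⟩
    push_cast
    field_simp
  have hne : ζ ≠ 1 := by
    rw [hζ, Ne, Complex.exp_eq_one_iff]
    rintro ⟨i, hi⟩
    have h2 : (2 * Real.pi * Complex.I : ℂ) ≠ 0 := Complex.two_pi_I_ne_zero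
    rw [mul_comm (i : ℂ)] at hi
    have h3 := mul_left_cancel₀ h2 hi
    rw [div_eq_iff hM'] at h3
    have h4 : ((k : ℕ) : ℤ) - (l : ℕ) = i * M := by exact_mod_cast h3
    have hk := k.2
    have hl := l.2
    have hi0 : i = 0 := by
      by_contra hi0
      have : (1 : ℤ) ≤ |i| := Int.one_le_abs hi0
      have h5 : |((k : ℕ) : ℤ) - (l : ℕ)| < M := by rw [abs_lt]; omega
      rw [h4, abs_mul, Nat.abs_cast] at h5
      nlinarith
    rw [hi0, zero_mul] at h4
    exact hkl (Fin.ext (by omega))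
  simp_rw [hterm]
  rw [← Finset.mul_sum]
  have := geom_sum_mul ζ N
  rw [hpow, sub_self] at this
  rw [(mul_eq_zero.1 this).resolve_right (sub_ne_zero.2 hne), mul_zero]

/-! ### Probability estimates for the walk -/

section RandomWalk

variable {Ω : Type*} [MeasurableSpace Ω] {P : Measure Ω} {G : ℕ → Ω → ℂ}

theorem measure_walk_tail (hG_indep : iIndepFun G P)
    (hG_law : ∀ j, HasLaw (G j) (stdGaussian ℂ) P) {N : ℕ} (hN : 0 < N) (x : ℝ) {t : ℝ}
    (ht : 0 ≤ t) :
    P {ω | t < ‖walk (fun j => G j ω) N x‖} =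
      ENNReal.ofReal (Real.exp (-t ^ 2 / (2 * N))) := by
  simp_rw [walk_eq]
  refine measure_sum_mul_gaussian_tail_eq hG_indep hG_law N _ ht (by exact_mod_cast hN) ?_
  simp [norm_walkCoef]

/-- Each coefficient changes by at most 2πNd, so the increment has variance parameter at most
N(2πNd)². The bound is useful when Nd is small. -/
theorem measure_walk_sub_gt_le (hG_indep : iIndepFun G P)
    (hG_law : ∀ j, HasLaw (G j) (stdGaussian ℂ) P) {N : ℕ} (hN : 0 < N) {x y d : ℝ} (hd : 0 < d)
    (hxy : |x - y| ≤ d) :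
    P {ω | √N < ‖walk (fun j => G j ω) N x - walk (fun j => G j ω) N y‖} ≤
      ENNReal.ofReal (Real.exp (-(1 / (8 * Real.pi ^ 2 * (N * d) ^ 2)))) := by
  have hN' : (0 : ℝ) < N := by exact_mod_cast hN
  simp_rw [walk_eq, ← Finset.sum_sub_distrib, ← sub_mul]
  refine (measure_sum_mul_gaussian_tail_le hG_indep hG_law N _ (Real.sqrt_nonneg _)
    (v := N * (2 * Real.pi * (N * d)) ^ 2) (by positivity) ?_).trans_eq ?_
  · calc ∑ j ∈ Finset.range N, ‖walkCoef x j - walkCoef y j‖ ^ 2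
        ≤ ∑ j ∈ Finset.range N, (2 * Real.pi * (N * d)) ^ 2 := by
          refine Finset.sum_le_sum fun j hj => pow_le_pow_left₀ (norm_nonneg _) ?_ 2
          refine (norm_walkCoef_sub_le x y j).trans ?_
          have : (j : ℝ) + 1 ≤ N := by exact_mod_cast Finset.mem_range.1 hj
          rw [mul_assoc (2 * Real.pi)]
          gcongr
      _ = _ := by simp
  · rw [Real.sq_sqrt hN'.le]
    congr 2
    field_simp
    ring

/-- The difference is a combination of only the N - N' last steps, with unimodular coefficients. -/
theorem measure_walk_sub_walk_gt_le (hG_indep : iIndepFun G P)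
    (hG_law : ∀ j, HasLaw (G j) (stdGaussian ℂ) P) {N N' : ℕ} (hN : N' ≤ N) {R : ℝ} (hR : 0 < R)
    (hNR : (N : ℝ) - N' ≤ R) (x : ℝ) :
    P {ω | √N < ‖walk (fun j => G j ω) N x - walk (fun j => G j ω) N' x‖} ≤
      ENNReal.ofReal (Real.exp (-(N / (2 * R)))) := by
  have h : ∀ ω, walk (fun j => G j ω) N x - walk (fun j => G j ω) N' x =
      ∑ j ∈ Finset.range N, (if j < N' then 0 else walkCoef x j) * G j ω := by
    intro ω
    have h1 : ∑ j ∈ Finset.range N', (if j < N' then 0 else walkCoef x j) * G j ω = 0 :=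
      Finset.sum_eq_zero fun j hj => by rw [if_pos (Finset.mem_range.1 hj), zero_mul]
    have h2 : ∑ j ∈ Finset.Ico N' N, (if j < N' then 0 else walkCoef x j) * G j ω =
        ∑ j ∈ Finset.Ico N' N, walkCoef x j * G j ω :=
      Finset.sum_congr rfl fun j hj => by rw [if_neg (not_lt.2 (Finset.mem_Ico.1 hj).1)]
    rw [walk_eq, walk_eq, ← Finset.sum_range_add_sum_Ico _ hN, ← Finset.sum_range_add_sum_Ico _ hN,
      h1, h2]
    ring
  simp_rw [h]
  refine (measure_sum_mul_gaussian_tail_le hG_indep hG_law N _ (Real.sqrt_nonneg _) hR ?_).trans_eq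
    ?_
  · rw [← Finset.sum_range_add_sum_Ico _ hN, Finset.sum_eq_zero fun j hj => by
      rw [if_pos (Finset.mem_range.1 hj), norm_zero, zero_pow two_ne_zero], zero_add,
      Finset.sum_congr rfl fun j hj => by
        rw [if_neg (not_lt.2 (Finset.mem_Ico.1 hj).1), norm_walkCoef, one_pow]]
    simpa [Nat.cast_sub hN] using hNR
  · rw [Real.sq_sqrt (Nat.cast_nonneg _), neg_div]

/-- At the multiples of `1 / M` the walk takes independent values at the times divisible by `M`. -/
theorem iIndepFun_walk (hG_indep : iIndepFun G P)
    (hG_law : ∀ j, HasLaw (G j) (stdGaussian ℂ) P) {M N : ℕ} (hMN : M ∣ N) :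
    iIndepFun (fun (k : Fin M) ω => walk (fun j => G j ω) N ((k : ℕ) / (M : ℝ))) P := by
  simp_rw [walk_eq]
  exact iIndepFun_sum_mul_gaussian hG_indep hG_law N (fun k => walkCoef ((k : ℕ) / (M : ℝ)))
    fun k l hkl => sum_walkCoef_mul_conj hMN hkl

/-- By independence the probability is (1 - p)^|S| with p the tail probability, and 1 - p ≤ exp(-p).
-/
theorem measure_forall_walk_le (hG_indep : iIndepFun G P)
    (hG_law : ∀ j, HasLaw (G j) (stdGaussian ℂ) P) {M N : ℕ} (hMN : M ∣ N) (hN : 0 < N) {t : ℝ}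
    (ht : 0 ≤ t) (S : Finset (Fin M)) :
    P {ω | ∀ k ∈ S, ‖walk (fun j => G j ω) N ((k : ℕ) / (M : ℝ))‖ ≤ t} ≤
      ENNReal.ofReal (Real.exp (-(S.card * Real.exp (-t ^ 2 / (2 * N))))) := by
  have := hG_indep.isProbabilityMeasure
  have hm : MeasurableSet {z : ℂ | ‖z‖ ≤ t} := measurableSet_le measurable_norm measurable_const
  have hind := (iIndepFun_walk hG_indep hG_law hMN).measure_inter_preimage_eq_mul S
    (sets := fun _ => {z : ℂ | ‖z‖ ≤ t}) fun _ _ => hm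
  have hone : ∀ k : Fin M, P ((fun ω => walk (fun j => G j ω) N ((k : ℕ) / (M : ℝ))) ⁻¹'
      {z : ℂ | ‖z‖ ≤ t}) ≤ ENNReal.ofReal (Real.exp (-Real.exp (-t ^ 2 / (2 * N)))) := by
    intro k
    have haem : AEMeasurable (fun ω => walk (fun j => G j ω) N ((k : ℕ) / (M : ℝ))) P := by
      simp_rw [walk_eq]
      exact aemeasurable_sum_mul_gaussian hG_law N _
    have hset : (fun ω => walk (fun j => G j ω) N ((k : ℕ) / (M : ℝ))) ⁻¹' {z : ℂ | ‖z‖ ≤ t} =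
        {ω | t < ‖walk (fun j => G j ω) N ((k : ℕ) / (M : ℝ))‖}ᶜ := by
      ext ω
      simp
    rw [hset, prob_compl_eq_one_sub₀, measure_walk_tail hG_indep hG_law hN _ ht,
      ← ENNReal.ofReal_one, ← ENNReal.ofReal_sub _ (Real.exp_pos _).le]
    · exact ENNReal.ofReal_le_ofReal (Real.one_sub_le_exp_neg _)
    · exact haem.nullMeasurableSet_preimage
        (measurableSet_lt measurable_const measurable_norm : MeasurableSet {z : ℂ | t < ‖z‖})
  have hset : {ω | ∀ k ∈ S, ‖walk (fun j => G j ω) N ((k : ℕ) / (M : ℝ))‖ ≤ t} =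
      ⋂ k ∈ S, (fun ω => walk (fun j => G j ω) N ((k : ℕ) / (M : ℝ))) ⁻¹' {z : ℂ | ‖z‖ ≤ t} := by
    ext ω
    simp
  rw [hset, hind]
  refine (Finset.prod_le_pow_card _ _ _ fun k _ => hone k).trans_eq ?_
  rw [← ENNReal.ofReal_pow (Real.exp_pos _).le, ← Real.exp_nat_mul]
  congr 2
  ring

end RandomWalk

/-! ### Upper bounds for the dimension -/

theorem exp_neg_mul_log_natFloor_le {q a : ℝ} (hq : 1 < q) (ha : 0 ≤ a) (n : ℕ) :
    Real.exp (-(a * Real.log ⌊q ^ n⌋₊)) ≤ 2 ^ a * (q ^ (-a)) ^ n := by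
  have hq0 : 0 < q := by linarith
  have h := half_pow_le_natFloor hq n
  have hN : (0 : ℝ) < ⌊q ^ n⌋₊ := lt_of_lt_of_le (by positivity) h
  have h1 : Real.exp (-(a * Real.log ⌊q ^ n⌋₊)) = ((⌊q ^ n⌋₊ : ℕ) : ℝ) ^ (-a) := by
    rw [Real.rpow_def_of_pos hN]
    congr 1
    ring
  rw [h1]
  refine (Real.rpow_le_rpow_of_nonpos (by positivity) h (by linarith)).trans_eq ?_
  rw [Real.div_rpow (by positivity) two_pos.le, Real.rpow_neg two_pos.le, div_inv_eq_mul, mul_comm,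
    ← Real.rpow_natCast, ← Real.rpow_natCast, ← Real.rpow_mul hq0.le, ← Real.rpow_mul hq0.le]
  congr 2
  ring

theorem natFloor_pow_pos {q : ℝ} (hq : 1 < q) (n : ℕ) : 0 < ⌊q ^ n⌋₊ :=
  Nat.floor_pos.2 (one_le_pow₀ hq.le)

theorem rpow_eq_two_rpow_logb {q : ℝ} (hq : 0 < q) (a : ℝ) : q ^ a = 2 ^ (a * Real.logb 2 q) := by
  rw [mul_comm, Real.rpow_mul two_pos.le, Real.rpow_logb two_pos (by norm_num) hq]

theorem abs_div_sub_natDiv_div_le {m n : ℕ} (hmn : m ≤ n) (i : ℕ) :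
    |(i : ℝ) / 2 ^ n - ((i / 2 ^ (n - m) : ℕ) : ℝ) / 2 ^ m| ≤ 1 / 2 ^ m := by
  have hd := Nat.div_add_mod i (2 ^ (n - m))
  have hlt := Nat.mod_lt i (show 0 < 2 ^ (n - m) by positivity)
  have h1 : (i : ℝ) = 2 ^ (n - m) * ((i / 2 ^ (n - m) : ℕ) : ℝ) + ((i % 2 ^ (n - m) : ℕ) : ℝ) := by
    exact_mod_cast hd.symm
  have h2 : ((i % 2 ^ (n - m) : ℕ) : ℝ) ≤ 2 ^ (n - m) := by exact_mod_cast hlt.le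
  have h3 : (2 : ℝ) ^ n = 2 ^ (n - m) * 2 ^ m := by rw [← pow_add, Nat.sub_add_cancel hmn]
  have h4 : (i : ℝ) / 2 ^ n - ((i / 2 ^ (n - m) : ℕ) : ℝ) / 2 ^ m =
      ((i % 2 ^ (n - m) : ℕ) : ℝ) / 2 ^ n := by
    nth_rewrite 1 [h1]
    rw [h3]
    field_simp
    ring
  rw [h4, abs_of_nonneg (by positivity), h3, div_le_div_iff₀ (by positivity) (by positivity)]
  have : (0 : ℝ) < 2 ^ m := by positivity
  nlinarith

section RandomWalk

variable {Ω : Type*} [MeasurableSpace Ω] {P : Measure Ω} {G : ℕ → Ω → ℂ}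

/-- At most A^n pairs of points are involved, and each fails with probability at most exp(-c
r^(-2n)), so a union bound is summable. Used for passing to coarser cells in the upper bound and for
rounding to the dyadic grid in the lower bound. -/
theorem tsum_measure_exists_walk_sub_gt_ne_top (hG_indep : iIndepFun G P)
    (hG_law : ∀ j, HasLaw (G j) (stdGaussian ℂ) P) {q A r : ℝ} (hq : 1 < q) (hA : 0 ≤ A)
    (hr0 : 0 < r) (hr1 : r < 1) {K : ℕ → ℕ} (hK : ∀ n, (K n : ℝ) ≤ A ^ n) {x y : ℕ → ℕ → ℝ}
    {d : ℕ → ℝ} (hd : ∀ n, 0 < d n) (hNd : ∀ n, (⌊q ^ n⌋₊ : ℝ) * d n ≤ r ^ n)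
    (hxy : ∀ n i, i < K n → |x n i - y n i| ≤ d n) :
    ∑' n, P {ω | ∃ i : ℕ, i < K n ∧ √⌊q ^ n⌋₊ < ‖walk (fun j => G j ω) ⌊q ^ n⌋₊ (x n i) -
      walk (fun j => G j ω) ⌊q ^ n⌋₊ (y n i)‖} ≠ ⊤ := by
  have hρ : 1 < r⁻¹ ^ 2 := one_lt_pow₀ ((one_lt_inv₀ hr0).2 hr1) two_ne_zero
  have hc : 0 < (8 * Real.pi ^ 2)⁻¹ := by positivity
  refine ne_top_of_le_ne_top (summable_pow_mul_exp_neg_pow hA hc hρ).tsum_ofReal_ne_top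
    (ENNReal.tsum_le_tsum fun n => ?_)
  have hN : (0 : ℝ) < ⌊q ^ n⌋₊ := by exact_mod_cast natFloor_pow_pos hq n
  have hsub : {ω | ∃ i : ℕ, i < K n ∧ √⌊q ^ n⌋₊ < ‖walk (fun j => G j ω) ⌊q ^ n⌋₊ (x n i) -
      walk (fun j => G j ω) ⌊q ^ n⌋₊ (y n i)‖} ⊆ ⋃ i ∈ Finset.range (K n),
      {ω | √⌊q ^ n⌋₊ < ‖walk (fun j => G j ω) ⌊q ^ n⌋₊ (x n i) -
        walk (fun j => G j ω) ⌊q ^ n⌋₊ (y n i)‖} := by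
    rintro ω ⟨i, hi, h⟩
    exact Set.mem_biUnion (Finset.mem_coe.2 (Finset.mem_range.2 hi)) h
  calc _ ≤ ∑ i ∈ Finset.range (K n), P {ω | √⌊q ^ n⌋₊ < ‖walk (fun j => G j ω) ⌊q ^ n⌋₊ (x n i) -
        walk (fun j => G j ω) ⌊q ^ n⌋₊ (y n i)‖} :=
        (measure_mono hsub).trans (measure_biUnion_finset_le _ _)
    _ ≤ ∑ i ∈ Finset.range (K n), ENNReal.ofReal
          (Real.exp (-(1 / (8 * Real.pi ^ 2 * (⌊q ^ n⌋₊ * d n) ^ 2)))) :=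
        Finset.sum_le_sum fun i hi => measure_walk_sub_gt_le hG_indep hG_law
          (natFloor_pow_pos hq n) (hd n) (hxy n i (Finset.mem_range.1 hi))
    _ = ENNReal.ofReal (K n * Real.exp (-(1 / (8 * Real.pi ^ 2 * (⌊q ^ n⌋₊ * d n) ^ 2)))) := by
        rw [Finset.sum_const, Finset.card_range, nsmul_eq_mul, ENNReal.ofReal_mul (by positivity),
          ENNReal.ofReal_natCast]
    _ ≤ _ := by
        refine ENNReal.ofReal_le_ofReal (mul_le_mul (hK n) (Real.exp_le_exp.2 (neg_le_neg ?_))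
          (Real.exp_pos _).le (by positivity))
        have h0 : 0 < (⌊q ^ n⌋₊ : ℝ) * d n := mul_pos hN (hd n)
        have h1 : (r⁻¹ ^ 2) ^ n = ((r ^ n) ^ 2)⁻¹ := by
          rw [inv_pow, inv_pow, ← pow_mul, ← pow_mul, mul_comm]
        have h2 := hNd n
        rw [one_div, mul_inv (8 * Real.pi ^ 2), h1]
        gcongr

/-- First moment at level ⌈λn⌉: the expected sum of `s`-th powers over good cells is at most a
constant times (2^(λ(1-s)) q^(-β))^n. `herr` allows the walk to be evaluated at the left ends of
these coarser cells. -/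
theorem ae_dimH_treeExceptionalSet_le (hG_indep : iIndepFun G P)
    (hG_law : ∀ j, HasLaw (G j) (stdGaussian ℂ) P) {α q lam s : ℝ} (hq : 1 < q)
    (hlam0 : 0 < lam) (hlam1 : lam ≤ 1) (hs0 : 0 ≤ s) (hs1 : s ≤ 1)
    (h : lam * (1 - s) < α * Real.logb 2 q)
    (herr : ∑' n : ℕ, P {ω | ∃ i : ℕ, i < 2 ^ n ∧ √⌊q ^ n⌋₊ <
      ‖walk (fun j => G j ω) ⌊q ^ n⌋₊ ((i : ℝ) / 2 ^ n) - walk (fun j => G j ω) ⌊q ^ n⌋₊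
        (((i / 2 ^ (n - ⌈lam * n⌉₊) : ℕ) : ℝ) / 2 ^ ⌈lam * n⌉₊)‖} ≠ ⊤) :
    ∀ᵐ ω ∂P, dimH (treeExceptionalSet (fun j => G j ω) α q) ≤ ENNReal.ofReal s := by
  have hL : 0 < Real.logb 2 q := Real.logb_pos one_lt_two hq
  have hq0 : 0 < q := by linarith
  -- β < α leaves room for the error √N, and is still large enough for the series to converge.
  obtain ⟨β, hβ1, hβ2⟩ := exists_between ((div_lt_iff₀ hL).2 h)
  have hβ0 : 0 < β := lt_of_le_of_lt (by have := sub_nonneg.2 hs1; positivity) hβ1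
  rw [div_lt_iff₀ hL] at hβ1
  let m : ℕ → ℕ := fun n => ⌈lam * n⌉₊
  have hm : Monotone m := fun a b hab => Nat.ceil_mono (by gcongr)
  have hm' : Tendsto m atTop atTop :=
    tendsto_nat_ceil_atTop.comp (tendsto_natCast_atTop_atTop.const_mul_atTop hlam0)
  have hmn : ∀ n, m n ≤ n := fun n =>
    Nat.ceil_le.2 (mul_le_of_le_one_left (by positivity) hlam1)
  have hm1 : ∀ n, (m n : ℝ) ≤ lam * n + 1 := fun n => (Nat.ceil_lt_add_one (by positivity)).le
  let A : ℕ → ℕ → Set Ω := fun n c => {ω | c < 2 ^ m n ∧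
    threshold β ⌊q ^ n⌋₊ < ‖walk (fun j => G j ω) ⌊q ^ n⌋₊ ((c : ℝ) / 2 ^ m n)‖}
  have hsum : ∑' n, ∑' c, ENNReal.ofReal (1 / 2 ^ m n) ^ s * P (A n c) ≠ ⊤ := by
    have hρ : (2 : ℝ) ^ (lam * (1 - s)) * q ^ (-β) < 1 := by
      rw [rpow_eq_two_rpow_logb hq0, ← Real.rpow_add two_pos]
      exact Real.rpow_lt_one_of_one_lt_of_neg one_lt_two (by linarith)
    have hgeo := (summable_geometric_of_lt_one (by positivity) hρ).mul_left (2 * 2 ^ β)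
    refine ne_top_of_le_ne_top hgeo.tsum_ofReal_ne_top (ENNReal.tsum_le_tsum fun n => ?_)
    have hzero : ∀ c ∉ Finset.range (2 ^ m n), ENNReal.ofReal (1 / 2 ^ m n) ^ s * P (A n c) = 0 := by
      intro c hc
      have : A n c = ∅ := by
        ext ω
        simp only [A, Set.mem_ofPred_eq, Set.mem_empty_iff_false, iff_false, not_and]
        exact fun hlt => absurd (Finset.mem_range.2 hlt) hc
      rw [this, measure_empty, mul_zero]
    have hA : ∀ c, P (A n c) ≤ ENNReal.ofReal (Real.exp (-(β * Real.log ⌊q ^ n⌋₊))) := by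
      intro c
      refine (measure_mono fun ω hω => hω.2).trans ((measure_walk_tail hG_indep hG_law
        (natFloor_pow_pos hq n) ((c : ℝ) / 2 ^ m n) (threshold_nonneg β _)).trans_le ?_)
      have hN : (0 : ℝ) < ⌊q ^ n⌋₊ := by exact_mod_cast natFloor_pow_pos hq n
      rw [threshold_sq hβ0.le]
      refine ENNReal.ofReal_le_ofReal (le_of_eq ?_)
      congr 1
      field_simp
    rw [tsum_eq_sum hzero]
    calc _ ≤ ∑ c ∈ Finset.range (2 ^ m n), ENNReal.ofReal (1 / 2 ^ m n) ^ s *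
            ENNReal.ofReal (Real.exp (-(β * Real.log ⌊q ^ n⌋₊))) := by
          gcongr with c
          exact hA c
      _ = ENNReal.ofReal (2 ^ m n * ((1 / 2 ^ m n) ^ s *
            Real.exp (-(β * Real.log ⌊q ^ n⌋₊)))) := by
          rw [Finset.sum_const, Finset.card_range, nsmul_eq_mul, ENNReal.ofReal_mul (by positivity),
            ENNReal.ofReal_mul (by positivity), ENNReal.ofReal_rpow_of_nonneg (by positivity) hs0]
          congr 1
          rw [← ENNReal.ofReal_natCast]
          push_cast
          rfl
      _ ≤ _ := by
          refine ENNReal.ofReal_le_ofReal ?_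
          have h1 : (2 : ℝ) ^ m n * (1 / 2 ^ m n) ^ s ≤ 2 * (2 ^ (lam * (1 - s))) ^ n := by
            have e1 : (2 : ℝ) ^ m n * (1 / 2 ^ m n) ^ s = 2 ^ (m n * (1 - s)) := by
              rw [← Real.rpow_natCast 2 (m n), one_div, ← Real.rpow_neg two_pos.le,
                ← Real.rpow_mul two_pos.le, ← Real.rpow_add two_pos]
              congr 1
              ring
            have e2 : (2 : ℝ) * (2 ^ (lam * (1 - s))) ^ n = 2 ^ (1 + lam * (1 - s) * n) := by
              rw [Real.rpow_add two_pos, Real.rpow_one, ← Real.rpow_natCast,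
                ← Real.rpow_mul two_pos.le]
            rw [e1, e2]
            refine Real.rpow_le_rpow_of_exponent_le one_le_two ?_
            have := mul_le_mul_of_nonneg_right (hm1 n) (sub_nonneg.2 hs1)
            linarith
          rw [← mul_assoc]
          refine (mul_le_mul h1 (exp_neg_mul_log_natFloor_le hq hβ0.le n) (Real.exp_pos _).le
            (by positivity)).trans_eq ?_
          rw [mul_pow]
          ring
  filter_upwards [ae_tsum_indicator_ne_top hsum, ae_eventually_notMem herr] with ω hω1 hω2
  refine dimH_limsup_dyadic_le (m := m) hm hm' (F := fun n => {c | ω ∈ A n c}) hs0 hω1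
    fun θ hθ => ⟨hθ.1.1, ?_⟩
  have hthr := (tendsto_natFloor_pow hq).eventually (eventually_threshold_add_sqrt_le hβ0.le hβ2)
  refine (hθ.2.and_eventually (hω2.and hthr)).mono fun n hn => ?_
  obtain ⟨hn1, hn2, hn3⟩ := hn
  refine ⟨dyadicIndex_lt hθ.1, ?_⟩
  simp only [not_exists, not_and, not_lt] at hn2
  have hn4 := hn2 _ (dyadicIndex_lt hθ.1)
  rw [dyadicIndex_div (hmn n)] at hn4
  have := norm_sub_norm_le (walk (fun j => G j ω) ⌊q ^ n⌋₊ ((dyadicIndex n θ : ℝ) / 2 ^ n))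
    (walk (fun j => G j ω) ⌊q ^ n⌋₊ ((dyadicIndex (m n) θ : ℝ) / 2 ^ m n))
  change _ - _ ≤ ‖_ - walk (fun j => G j ω) ⌊q ^ n⌋₊ (_ / 2 ^ (⌈lam * n⌉₊))‖ at this
  linarith

/-- For λ > log₂ q the ratio r = q 2^(-λ) is below 1, so cells of level ⌈λn⌉ are much shorter than
1/N, the scale on which the walk oscillates. -/
theorem ae_dimH_treeExceptionalSet_le_of_logb_lt (hG_indep : iIndepFun G P)
    (hG_law : ∀ j, HasLaw (G j) (stdGaussian ℂ) P) {α q lam s : ℝ} (hq : 1 < q)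
    (hlam0 : Real.logb 2 q < lam) (hlam1 : lam ≤ 1) (hs0 : 0 ≤ s) (hs1 : s ≤ 1)
    (h : lam * (1 - s) < α * Real.logb 2 q) :
    ∀ᵐ ω ∂P, dimH (treeExceptionalSet (fun j => G j ω) α q) ≤ ENNReal.ofReal s := by
  have hL : 0 < Real.logb 2 q := Real.logb_pos one_lt_two hq
  have hq0 : 0 < q := by linarith
  have hlam : 0 < lam := hL.trans hlam0
  have hr1 : q * 2 ^ (-lam) < 1 := by
    rw [← Real.rpow_one q, rpow_eq_two_rpow_logb hq0, ← Real.rpow_add two_pos]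
    exact Real.rpow_lt_one_of_one_lt_of_neg one_lt_two (by linarith)
  refine ae_dimH_treeExceptionalSet_le hG_indep hG_law hq hlam hlam1 hs0 hs1 h ?_
  refine tsum_measure_exists_walk_sub_gt_ne_top hG_indep hG_law hq (A := 2) two_pos.le
    (r := q * 2 ^ (-lam)) (by positivity) hr1 (K := fun n => 2 ^ n) (fun n => by simp)
    (d := fun n => 1 / 2 ^ ⌈lam * n⌉₊) (fun n => by positivity) (fun n => ?_) fun n i _ =>
      abs_div_sub_natDiv_div_le (Nat.ceil_le.2 (mul_le_of_le_one_left (by positivity) hlam1)) i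
  rw [mul_pow]
  refine mul_le_mul (natFloor_pow_le hq n) ?_ (by positivity) (by positivity)
  rw [one_div, ← Real.rpow_natCast, ← Real.rpow_neg two_pos.le, ← Real.rpow_natCast,
    ← Real.rpow_mul two_pos.le]
  refine Real.rpow_le_rpow_of_exponent_le one_le_two ?_
  have := Nat.le_ceil (lam * n)
  linarith

/-- With λ = 1 the coarser cell is the cell itself and the error events are empty. -/
theorem ae_dimH_treeExceptionalSet_le_of_lt (hG_indep : iIndepFun G P)
    (hG_law : ∀ j, HasLaw (G j) (stdGaussian ℂ) P) {α q s : ℝ} (hq : 1 < q)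
    (hs0 : 0 ≤ s) (hs1 : s ≤ 1) (h : 1 - s < α * Real.logb 2 q) :
    ∀ᵐ ω ∂P, dimH (treeExceptionalSet (fun j => G j ω) α q) ≤ ENNReal.ofReal s := by
  refine ae_dimH_treeExceptionalSet_le hG_indep hG_law hq one_pos le_rfl hs0 hs1
    (by linarith) ?_
  have : ∀ n : ℕ, {ω | ∃ i : ℕ, i < 2 ^ n ∧ √⌊q ^ n⌋₊ <
      ‖walk (fun j => G j ω) ⌊q ^ n⌋₊ ((i : ℝ) / 2 ^ n) - walk (fun j => G j ω) ⌊q ^ n⌋₊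
        (((i / 2 ^ (n - ⌈(1 : ℝ) * n⌉₊) : ℕ) : ℝ) / 2 ^ ⌈(1 : ℝ) * n⌉₊)‖} = ∅ := by
    intro n
    ext ω
    simp
  simp_rw [this]
  simp

end RandomWalk

/-! ### Lower bounds for the dimension -/

theorem ae_eventually_notMem_of_le_ofReal {Ω : Type*} [MeasurableSpace Ω] {P : Measure Ω}
    {A : ℕ → Set Ω} {f : ℕ → ℝ} (hf : Summable f) (h : ∀ᶠ n in atTop, P (A n) ≤ ENNReal.ofReal (f n)) :
    ∀ᵐ ω ∂P, ∀ᶠ n in atTop, ω ∉ A n := by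
  obtain ⟨n₀, hn₀⟩ := eventually_atTop.1 h
  have hsum : ∑' n, P (A (n + n₀)) ≠ ⊤ :=
    ne_top_of_le_ne_top ((summable_nat_add_iff n₀).2 hf).tsum_ofReal_ne_top
      (ENNReal.tsum_le_tsum fun n => hn₀ _ (Nat.le_add_left _ _))
  filter_upwards [ae_eventually_notMem hsum] with ω hω
  obtain ⟨a, ha⟩ := eventually_atTop.1 hω
  filter_upwards [eventually_ge_atTop (a + n₀)] with n hn
  simpa [Nat.sub_add_cancel (show n₀ ≤ n by omega)] using ha (n - n₀) (by omega)

/-- Every dyadic cell of level `m` contains at least `⌊M / 2 ^ m⌋` multiples of `1 / M`. -/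
theorem natDiv_le_card_dyadic {M n m c : ℕ} (hmn : m ≤ n) (hc : c < 2 ^ m) :
    M / 2 ^ m ≤
      (Finset.univ.filter fun k : Fin M => 2 ^ n * (k : ℕ) / M / 2 ^ (n - m) = c).card := by
  rcases Nat.eq_zero_or_pos (M / 2 ^ m) with h0 | hpos
  · rw [h0]; exact Nat.zero_le _
  have h2m : 0 < 2 ^ m := by positivity
  have hM : 0 < M := Nat.pos_of_ne_zero fun h => by simp [h] at hpos
  -- The rounded-up quotient of `c * M` by `2 ^ m`: `a / M` is the first multiple of 1/M in the
  -- cell, and the following ones are counted from it.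
  set a : ℕ := (c * M + 2 ^ m - 1) / 2 ^ m with ha
  have ha1 : c * M ≤ 2 ^ m * a := by
    have h1 := Nat.div_add_mod (c * M + 2 ^ m - 1) (2 ^ m)
    have h2 := Nat.mod_lt (c * M + 2 ^ m - 1) h2m
    rw [← ha] at h1
    omega
  have ha2 : 2 ^ m * a < c * M + 2 ^ m := by
    have h1 := Nat.div_mul_le_self (c * M + 2 ^ m - 1) (2 ^ m)
    rw [← ha, mul_comm] at h1
    omega
  have key : ∀ j, j < M / 2 ^ m → c * M ≤ 2 ^ m * (a + j) ∧ 2 ^ m * (a + j) < (c + 1) * M := by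
    intro j hj
    have h3 : 2 ^ m * (j + 1) ≤ M :=
      (Nat.mul_le_mul_left _ hj).trans (Nat.mul_div_le M (2 ^ m))
    rw [mul_add, add_mul, one_mul]
    rw [mul_add, mul_one] at h3
    omega
  have hlt : ∀ j, j < M / 2 ^ m → a + j < M := by
    intro j hj
    have h1 : 2 ^ m * (a + j) < 2 ^ m * M :=
      (key j hj).2.trans_le (Nat.mul_le_mul_right _ hc)
    exact Nat.lt_of_mul_lt_mul_left h1
  let f : Fin (M / 2 ^ m) → Fin M := fun j => ⟨a + j, hlt j j.2⟩
  have hf : Function.Injective f := fun i j hij => by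
    have := congrArg Fin.val hij
    simp only [f] at this
    exact Fin.ext (by omega)
  calc M / 2 ^ m = (Finset.univ.image f).card := by
        rw [Finset.card_image_of_injective _ hf, Finset.card_univ, Fintype.card_fin]
    _ ≤ _ := by
        refine Finset.card_le_card fun k hk => ?_
        obtain ⟨j, -, rfl⟩ := Finset.mem_image.1 hk
        rw [Finset.mem_filter]
        refine ⟨Finset.mem_univ _, ?_⟩
        obtain ⟨h1, h2⟩ := key j j.2
        have h3 : 2 ^ n = 2 ^ (n - m) * 2 ^ m := by rw [← pow_add, Nat.sub_add_cancel hmn]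
        rw [Nat.div_div_eq_div_mul, h3, mul_assoc, mul_comm M,
          Nat.mul_div_mul_left _ _ (by positivity)]
        exact Nat.div_eq_of_lt_le h1 h2

theorem abs_natDiv_div_sub_div_le {M n k : ℕ} (hM : 0 < M) :
    |((2 ^ n * k / M : ℕ) : ℝ) / 2 ^ n - k / M| ≤ 1 / 2 ^ n := by
  have hM' : (0 : ℝ) < M := by exact_mod_cast hM
  have h2 : (0 : ℝ) < 2 ^ n := by positivity
  have h3 : (2 : ℝ) ^ n * k / M = 2 ^ n * (k / M) := by ring
  have h4 : (2 : ℝ) ^ n * k / M = ((2 ^ n * k : ℕ) : ℝ) / (M : ℕ) := by push_cast; ring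
  have hle : ((2 ^ n * k / M : ℕ) : ℝ) ≤ 2 ^ n * (k / M) := by
    rw [← h3, h4]
    exact Nat.cast_div_le
  have hge : (2 : ℝ) ^ n * (k / M) ≤ ((2 ^ n * k / M : ℕ) : ℝ) + 1 := by
    rw [← h3, h4]
    rw [← Nat.floor_div_eq_div (K := ℝ)]
    exact (Nat.lt_floor_add_one _).le
  have h5 : ((2 ^ n * k / M : ℕ) : ℝ) / 2 ^ n - k / M =
      (((2 ^ n * k / M : ℕ) : ℝ) - 2 ^ n * (k / M)) / 2 ^ n := by
    field_simp
  rw [h5, abs_div, abs_of_pos h2]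
  gcongr
  rw [abs_le]
  constructor <;> linarith

section RandomWalk

variable {Ω : Type*} [MeasurableSpace Ω] {P : Measure Ω} {G : ℕ → Ω → ℂ}

/-- Lower bound for the dimension when the walk at the dyadic points is approximated by the values
at the multiples of `1 / M n` of the walk at a time `N' n` that is divisible by `M n`. -/
theorem ae_le_dimH_treeExceptionalSet (hG_indep : iIndepFun G P)
    (hG_law : ∀ j, HasLaw (G j) (stdGaussian ℂ) P) {α β q s κ ρ : ℝ} (hα : 0 < α) (hαβ : α < β)
    (hq : 1 < q) (hs0 : 0 < s) (hs1 : s ≤ 1) (hκ : 0 < κ) (hρ : 1 < ρ) {M N' : ℕ → ℕ}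
    (hMN : ∀ n, M n ∣ N' n)
    (hN' : ∀ γ < (1 : ℝ), ∀ᶠ n : ℕ in atTop, γ * ⌊q ^ n⌋₊ ≤ N' n)
    (hM : ∀ᶠ n : ℕ in atTop, κ * (ρ * q ^ β) ^ n ≤ (M n / 2 ^ ⌊s * n⌋₊ : ℕ))
    (herr : ∀ᵐ ω ∂P, ∀ᶠ n : ℕ in atTop, ∀ k < M n,
      ‖walk (fun j => G j ω) ⌊q ^ n⌋₊ (((2 ^ n * k / M n : ℕ) : ℝ) / 2 ^ n) -
        walk (fun j => G j ω) (N' n) (k / M n)‖ ≤ √⌊q ^ n⌋₊) :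
    ∀ᵐ ω ∂P, ENNReal.ofReal s ≤ dimH (treeExceptionalSet (fun j => G j ω) α q) := by
  have hq0 : 0 < q := by linarith
  have hβ : 0 < β := hα.trans hαβ
  -- The room between α and γ absorbs the approximation error √N, that between γ and β the
  -- replacement of the time ⌊qⁿ⌋ by `N' n`.
  obtain ⟨γ, hαγ, hγβ⟩ := exists_between hαβ
  have hγ : 0 < γ := hα.trans hαγ
  have hmn : ∀ n : ℕ, ⌊s * n⌋₊ ≤ n := fun n =>
    Nat.floor_le_of_le (mul_le_of_le_one_left (by positivity) hs1)
  let S : ℕ → ℕ → (n : ℕ) → Finset (Fin (M n)) := fun c m n =>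
    Finset.univ.filter fun k : Fin (M n) => 2 ^ n * (k : ℕ) / M n / 2 ^ (n - m) = c
  -- Some cell of level ⌊sn⌋ in which all multiples of 1/M fail.
  let bad : ℕ → Set Ω := fun n => {ω | ∃ c : ℕ, c < 2 ^ ⌊s * n⌋₊ ∧ ∀ k ∈ S c ⌊s * n⌋₊ n,
    ‖walk (fun j => G j ω) (N' n) ((k : ℕ) / (M n : ℝ))‖ ≤ threshold γ ⌊q ^ n⌋₊}
  have hbad : ∀ᵐ ω ∂P, ∀ᶠ n in atTop, ω ∉ bad n := by
    refine ae_eventually_notMem_of_le_ofReal (summable_pow_mul_exp_neg_pow two_pos.le hκ hρ) ?_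
    filter_upwards [hN' (γ / β) ((div_lt_one hβ).2 hγβ), hM] with n hn1 hn2
    have hN : (0 : ℝ) < ⌊q ^ n⌋₊ := by exact_mod_cast natFloor_pow_pos hq n
    have hN'0 : (0 : ℝ) < N' n := lt_of_lt_of_le (by positivity) hn1
    have hp : (q ^ (-β)) ^ n ≤ Real.exp (-threshold γ ⌊q ^ n⌋₊ ^ 2 / (2 * N' n)) := by
      rw [threshold_sq hγ.le, Real.rpow_def_of_pos hq0, ← Real.exp_nat_mul]
      refine Real.exp_le_exp.2 ?_
      rw [le_div_iff₀ (by positivity)]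
      have hlog : Real.log ⌊q ^ n⌋₊ ≤ n * Real.log q := by
        rw [← Real.log_pow]
        exact Real.log_le_log hN (natFloor_pow_le hq n)
      have hlog0 : 0 ≤ Real.log ⌊q ^ n⌋₊ := Real.log_natCast_nonneg _
      have h1 : γ * ⌊q ^ n⌋₊ ≤ β * N' n := by
        have := mul_le_mul_of_nonneg_left hn1 hβ.le
        rwa [← mul_assoc, mul_div_cancel₀ _ hβ.ne'] at this
      have h2 : γ * ⌊q ^ n⌋₊ * Real.log ⌊q ^ n⌋₊ ≤ β * N' n * (n * Real.log q) :=
        mul_le_mul h1 hlog hlog0 (by positivity)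
      nlinarith
    have hc : ∀ c < 2 ^ ⌊s * n⌋₊, P {ω | ∀ k ∈ S c ⌊s * n⌋₊ n,
        ‖walk (fun j => G j ω) (N' n) ((k : ℕ) / (M n : ℝ))‖ ≤ threshold γ ⌊q ^ n⌋₊} ≤
        ENNReal.ofReal (Real.exp (-(κ * ρ ^ n))) := by
      intro c hc
      refine (measure_forall_walk_le hG_indep hG_law (hMN n) (by exact_mod_cast hN'0)
        (threshold_nonneg γ _) _).trans (ENNReal.ofReal_le_ofReal (Real.exp_le_exp.2 (neg_le_neg ?_)))
      have hcard : κ * (ρ * q ^ β) ^ n ≤ (S c ⌊s * n⌋₊ n).card :=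
        hn2.trans (by exact_mod_cast natDiv_le_card_dyadic (hmn n) hc)
      -- A lower bound for the expected number of successes in one cell: number of points times
      -- success probability.
      calc κ * ρ ^ n = κ * (ρ * q ^ β) ^ n * (q ^ (-β)) ^ n := by
            rw [mul_assoc, ← mul_pow, mul_assoc ρ, ← Real.rpow_add hq0, add_neg_cancel,
              Real.rpow_zero, mul_one]
        _ ≤ _ := mul_le_mul hcard hp (by positivity) (by positivity)
    have hsub : bad n ⊆ ⋃ c ∈ Finset.range (2 ^ ⌊s * n⌋₊), {ω | ∀ k ∈ S c ⌊s * n⌋₊ n,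
        ‖walk (fun j => G j ω) (N' n) ((k : ℕ) / (M n : ℝ))‖ ≤ threshold γ ⌊q ^ n⌋₊} := by
      rintro ω ⟨c, hc, h⟩
      exact Set.mem_biUnion (Finset.mem_coe.2 (Finset.mem_range.2 hc)) h
    calc P (bad n) ≤ ∑ c ∈ Finset.range (2 ^ ⌊s * n⌋₊), P {ω | ∀ k ∈ S c ⌊s * n⌋₊ n,
          ‖walk (fun j => G j ω) (N' n) ((k : ℕ) / (M n : ℝ))‖ ≤ threshold γ ⌊q ^ n⌋₊} :=
          (measure_mono hsub).trans (measure_biUnion_finset_le _ _)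
      _ ≤ ∑ c ∈ Finset.range (2 ^ ⌊s * n⌋₊), ENNReal.ofReal (Real.exp (-(κ * ρ ^ n))) :=
          Finset.sum_le_sum fun c h => hc c (Finset.mem_range.1 h)
      _ = ENNReal.ofReal (2 ^ ⌊s * n⌋₊ * Real.exp (-(κ * ρ ^ n))) := by
          rw [Finset.sum_const, Finset.card_range, nsmul_eq_mul, ENNReal.ofReal_mul (by positivity),
            ← ENNReal.ofReal_natCast]
          push_cast
          rfl
      _ ≤ _ := by
          refine ENNReal.ofReal_le_ofReal ?_
          gcongr
          · exact one_le_two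
          · exact hmn n
  filter_upwards [hbad, herr] with ω hω1 hω2
  refine le_dimH_limsup_dyadic (E := fun n => {i | threshold α ⌊q ^ n⌋₊ <
    ‖walk (fun j => G j ω) ⌊q ^ n⌋₊ ((i : ℝ) / 2 ^ n)‖}) hs0 hs1 (Eventually.frequently ?_)
  have hthr := (tendsto_natFloor_pow hq).eventually (eventually_threshold_add_sqrt_le hα.le hαγ)
  filter_upwards [hω1, hω2, hthr] with n hn1 hn2 hn3 c hc
  have hex : ∃ k ∈ S c ⌊s * n⌋₊ n, threshold γ ⌊q ^ n⌋₊ <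
      ‖walk (fun j => G j ω) (N' n) ((k : ℕ) / (M n : ℝ))‖ := by
    by_contra! hcon
    exact hn1 ⟨c, hc, hcon⟩
  obtain ⟨k, hkS, hk⟩ := hex
  refine ⟨2 ^ n * (k : ℕ) / M n, ?_, (Finset.mem_filter.1 hkS).2⟩
  have h1 := hn2 k k.2
  have h2 := norm_sub_norm_le (walk (fun j => G j ω) (N' n) ((k : ℕ) / (M n : ℝ)))
    (walk (fun j => G j ω) ⌊q ^ n⌋₊ (((2 ^ n * (k : ℕ) / M n : ℕ) : ℝ) / 2 ^ n))
  rw [norm_sub_rev] at h2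
  change threshold α ⌊q ^ n⌋₊ < _
  linarith

/-- Take M = N' = ⌊qⁿ⌋. As q < 2, rounding a multiple of 1/N to the finer dyadic grid moves it by at
most 2^(-n), and N 2^(-n) ≤ (q/2)^n is negligible. -/
theorem ae_le_dimH_treeExceptionalSet_of_lt_two (hG_indep : iIndepFun G P)
    (hG_law : ∀ j, HasLaw (G j) (stdGaussian ℂ) P) {α q s : ℝ} (hα : 0 < α)
    (hq : 1 < q) (hq2 : q < 2) (hs0 : 0 < s) (h : s < (1 - α) * Real.logb 2 q) :
    ∀ᵐ ω ∂P, ENNReal.ofReal s ≤ dimH (treeExceptionalSet (fun j => G j ω) α q) := by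
  have hL : 0 < Real.logb 2 q := Real.logb_pos one_lt_two hq
  have hL1 : Real.logb 2 q < 1 := by
    rw [Real.logb_lt_iff_lt_rpow one_lt_two (by linarith), Real.rpow_one]
    exact hq2
  have hq0 : 0 < q := by linarith
  have hs1 : s ≤ 1 := by nlinarith
  have hsL : s / Real.logb 2 q < 1 - α := (div_lt_iff₀ hL).2 h
  obtain ⟨β, hαβ, hβ⟩ := exists_between (lt_sub_comm.1 hsL)
  have hβ' : s < (1 - β) * Real.logb 2 q := (div_lt_iff₀ hL).1 (lt_sub_comm.1 hβ)
  have hρ : 1 < q * 2 ^ (-s) * q ^ (-β) := by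
    nth_rewrite 1 [← Real.rpow_one q]
    rw [rpow_eq_two_rpow_logb hq0, rpow_eq_two_rpow_logb hq0 (-β), ← Real.rpow_add two_pos,
      ← Real.rpow_add two_pos]
    exact Real.one_lt_rpow one_lt_two (by linarith)
  have hσ : 1 < q * 2 ^ (-s) := hρ.trans_le
    (mul_le_of_le_one_right (by positivity)
      (Real.rpow_le_one_of_one_le_of_nonpos hq.le (by linarith)))
  -- In κ = 1/4 one factor 1/2 comes from ⌊qⁿ⌋ ≥ qⁿ/2, the other from the integer division, once the
  -- ratio is large.
  refine ae_le_dimH_treeExceptionalSet hG_indep hG_law hα hαβ hq hs0 hs1 (κ := 1 / 4) (by norm_num)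
    hρ (M := fun n => ⌊q ^ n⌋₊) (N' := fun n => ⌊q ^ n⌋₊) (fun n => dvd_rfl)
    (fun γ hγ => Eventually.of_forall fun n => mul_le_of_le_one_left (by positivity) hγ.le) ?_ ?_
  · filter_upwards [(tendsto_pow_atTop_atTop_of_one_lt hσ).eventually_ge_atTop 4] with n hn
    rw [mul_assoc (q * _), ← Real.rpow_add hq0, neg_add_cancel, Real.rpow_zero, mul_one]
    have h1 : ((⌊q ^ n⌋₊ : ℕ) : ℝ) / ((2 ^ ⌊s * n⌋₊ : ℕ) : ℝ) - 1 ≤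
        ((⌊q ^ n⌋₊ / 2 ^ ⌊s * n⌋₊ : ℕ) : ℝ) := by
      rw [← Nat.floor_div_eq_div (K := ℝ)]
      exact (Nat.sub_one_lt_floor _).le
    have h2 : (q * 2 ^ (-s)) ^ n / 2 ≤ ((⌊q ^ n⌋₊ : ℕ) : ℝ) / ((2 ^ ⌊s * n⌋₊ : ℕ) : ℝ) := by
      have h3 : ((2 : ℝ) ^ (-s)) ^ n ≤ (2 ^ ⌊s * n⌋₊)⁻¹ := by
        rw [← Real.rpow_natCast, ← Real.rpow_mul two_pos.le, ← Real.rpow_natCast,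
          ← Real.rpow_neg two_pos.le]
        refine Real.rpow_le_rpow_of_exponent_le one_le_two ?_
        have := Nat.floor_le (show 0 ≤ s * n by positivity)
        linarith
      rw [mul_pow, div_eq_mul_inv _ ((2 ^ ⌊s * n⌋₊ : ℕ) : ℝ), mul_div_right_comm]
      push_cast
      exact mul_le_mul (half_pow_le_natFloor hq n) h3 (by positivity) (by positivity)
    linarith
  · have := tsum_measure_exists_walk_sub_gt_ne_top hG_indep hG_law hq (A := q) hq0.le
      (r := q / 2) (by positivity) (by linarith) (K := fun n => ⌊q ^ n⌋₊)
      (fun n => natFloor_pow_le hq n) (x := fun n k => ((2 ^ n * k / ⌊q ^ n⌋₊ : ℕ) : ℝ) / 2 ^ n)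
      (y := fun n k => (k : ℝ) / ⌊q ^ n⌋₊) (d := fun n => 1 / 2 ^ n) (fun n => by positivity)
      (fun n => ?_) fun n k _ => abs_natDiv_div_sub_div_le (natFloor_pow_pos hq n)
    · filter_upwards [ae_eventually_notMem this] with ω hω
      refine hω.mono fun n hn => ?_
      simpa only [not_exists, not_and, not_lt] using hn
    · rw [div_pow, mul_one_div]
      exact div_le_div_of_nonneg_right (natFloor_pow_le hq n) (by positivity)

/-- Take M = 2ⁿ and for N' the largest multiple of 2ⁿ below or equal to N. As q > 2, the fewer than
2ⁿ discarded steps are negligible against N: they exceed √N with probability at most exp(-(q/2)^n /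
4). -/
theorem ae_le_dimH_treeExceptionalSet_of_two_lt (hG_indep : iIndepFun G P)
    (hG_law : ∀ j, HasLaw (G j) (stdGaussian ℂ) P) {α q s : ℝ} (hα : 0 < α)
    (hq : 2 < q) (hs0 : 0 < s) (h : s < 1 - α * Real.logb 2 q) :
    ∀ᵐ ω ∂P, ENNReal.ofReal s ≤ dimH (treeExceptionalSet (fun j => G j ω) α q) := by
  have hq1 : 1 < q := by linarith
  have hq0 : 0 < q := by linarith
  have hL : 0 < Real.logb 2 q := Real.logb_pos one_lt_two hq1
  have hs1 : s ≤ 1 := by nlinarith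
  obtain ⟨β, hαβ, hβ⟩ := exists_between ((lt_div_iff₀ hL).2 (lt_sub_comm.1 h))
  have hβ' : β * Real.logb 2 q < 1 - s := (lt_div_iff₀ hL).1 hβ
  have hρ : 1 < 2 ^ (1 - s) * q ^ (-β) := by
    rw [rpow_eq_two_rpow_logb hq0 (-β), ← Real.rpow_add two_pos]
    exact Real.one_lt_rpow one_lt_two (by linarith)
  have hq2 : 1 < q / 2 := by linarith
  refine ae_le_dimH_treeExceptionalSet hG_indep hG_law hα hαβ hq1 hs0 hs1 one_pos
    hρ (M := fun n => 2 ^ n) (N' := fun n => 2 ^ n * (⌊q ^ n⌋₊ / 2 ^ n))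
    (fun n => dvd_mul_right _ _) (fun γ hγ => ?_) (Eventually.of_forall fun n => ?_) ?_
  · have hγ' := sub_pos.2 hγ
    filter_upwards [(tendsto_pow_atTop_atTop_of_one_lt hq2).eventually_ge_atTop (2 / (1 - γ))]
      with n hn
    have h1 : (⌊q ^ n⌋₊ : ℝ) - 2 ^ n ≤ ((2 ^ n * (⌊q ^ n⌋₊ / 2 ^ n) : ℕ) : ℝ) := by
      have h2 := Nat.div_add_mod ⌊q ^ n⌋₊ (2 ^ n)
      have h3 := Nat.mod_lt ⌊q ^ n⌋₊ (show 0 < 2 ^ n by positivity)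
      have h4 : ⌊q ^ n⌋₊ ≤ 2 ^ n * (⌊q ^ n⌋₊ / 2 ^ n) + 2 ^ n := by omega
      rw [sub_le_iff_le_add]
      exact_mod_cast h4
    have h2 : (2 : ℝ) ^ n ≤ (1 - γ) * ⌊q ^ n⌋₊ := by
      have h3 := half_pow_le_natFloor hq1 n
      rw [div_pow, div_le_div_iff₀ hγ' (by positivity)] at hn
      nlinarith
    linarith
  · rw [one_mul, mul_assoc, ← Real.rpow_add hq0, neg_add_cancel, Real.rpow_zero, mul_one,
      Nat.pow_div (Nat.floor_le_of_le (mul_le_of_le_one_left (by positivity) hs1)) two_pos]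
    push_cast
    rw [← Real.rpow_natCast, ← Real.rpow_mul two_pos.le, ← Real.rpow_natCast]
    refine Real.rpow_le_rpow_of_exponent_le one_le_two ?_
    rw [Nat.cast_sub (Nat.floor_le_of_le (mul_le_of_le_one_left (by positivity) hs1))]
    have := Nat.floor_le (show 0 ≤ s * n by positivity)
    linarith
  · let A : ℕ → Set Ω := fun n => ⋃ k ∈ Finset.range (2 ^ n), {ω | √⌊q ^ n⌋₊ <
      ‖walk (fun j => G j ω) ⌊q ^ n⌋₊ ((k : ℝ) / 2 ^ n) -
        walk (fun j => G j ω) (2 ^ n * (⌊q ^ n⌋₊ / 2 ^ n)) ((k : ℝ) / 2 ^ n)‖}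
    have hA : ∀ᵐ ω ∂P, ∀ᶠ n in atTop, ω ∉ A n := by
      refine ae_eventually_notMem_of_le_ofReal (summable_pow_mul_exp_neg_pow (A := 2)
        (c := 1 / 4) two_pos.le (by norm_num) hq2) (Eventually.of_forall fun n => ?_)
      have hle : 2 ^ n * (⌊q ^ n⌋₊ / 2 ^ n) ≤ ⌊q ^ n⌋₊ := Nat.mul_div_le _ _
      have hR : (⌊q ^ n⌋₊ : ℝ) - ((2 ^ n * (⌊q ^ n⌋₊ / 2 ^ n) : ℕ) : ℝ) ≤ 2 ^ n := by
        have h2 := Nat.div_add_mod ⌊q ^ n⌋₊ (2 ^ n)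
        have h3 := Nat.mod_lt ⌊q ^ n⌋₊ (show 0 < 2 ^ n by positivity)
        have h4 : ⌊q ^ n⌋₊ ≤ 2 ^ n + 2 ^ n * (⌊q ^ n⌋₊ / 2 ^ n) := by omega
        rw [sub_le_iff_le_add]
        exact_mod_cast h4
      calc P (A n) ≤ ∑ k ∈ Finset.range (2 ^ n), ENNReal.ofReal
            (Real.exp (-(⌊q ^ n⌋₊ / (2 * 2 ^ n)))) :=
            (measure_biUnion_finset_le _ _).trans (Finset.sum_le_sum fun k _ =>
              measure_walk_sub_walk_gt_le hG_indep hG_law hle (by positivity) hR _)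
        _ = ENNReal.ofReal (2 ^ n * Real.exp (-(⌊q ^ n⌋₊ / (2 * 2 ^ n)))) := by
            rw [Finset.sum_const, Finset.card_range, nsmul_eq_mul,
              ENNReal.ofReal_mul (by positivity), ← ENNReal.ofReal_natCast]
            push_cast
            rfl
        _ ≤ _ := by
            refine ENNReal.ofReal_le_ofReal ?_
            have h3 := half_pow_le_natFloor hq1 n
            gcongr
            rw [div_pow, one_div_mul_eq_div, div_div, div_le_div_iff₀ (by positivity) (by positivity)]
            have : (0 : ℝ) < 2 ^ n := by positivity
            nlinarith
    filter_upwards [hA] with ω hω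
    refine hω.mono fun n hn k hk => ?_
    -- The sample points are the dyadic points themselves, so no rounding occurs.
    rw [Nat.mul_div_cancel_left k (by positivity)]
    by_contra! hcon
    refine hn (Set.mem_biUnion (Finset.mem_coe.2 (Finset.mem_range.2 hk)) ?_)
    push_cast at hcon
    exact hcon

end RandomWalk

/-! ### From rational exponents to the theorem -/

/-- Rational exponents suffice, so that only countably many null sets arise. `EReal` is needed
because the lower bound may be negative. -/
theorem EReal.coe_le_coe_ennreal_of_forall_rat {a : ℝ} {d : ENNReal}
    (h : ∀ s : ℚ, 0 < (s : ℝ) → (s : ℝ) < a → ENNReal.ofReal s ≤ d) : (a : EReal) ≤ (d : EReal) := by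
  have hle : ENNReal.ofReal a ≤ d := by
    refine le_of_forall_lt fun r hr => ?_
    lift r to NNReal using (hr.trans ENNReal.ofReal_lt_top).ne
    have ha : (r : ℝ) < a := by
      rwa [← ENNReal.ofReal_coe_nnreal, ENNReal.ofReal_lt_ofReal_iff_of_nonneg r.coe_nonneg] at hr
    obtain ⟨s, hs1, hs2⟩ := exists_rat_btwn ha
    refine lt_of_lt_of_le ?_ (h s (lt_of_le_of_lt r.coe_nonneg hs1) hs2)
    rw [← ENNReal.ofReal_coe_nnreal]
    exact (ENNReal.ofReal_lt_ofReal_iff (lt_of_le_of_lt r.coe_nonneg hs1)).2 hs1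
  calc (a : EReal) ≤ (ENNReal.ofReal a : EReal) := by
        rw [EReal.coe_ennreal_ofReal]
        exact EReal.coe_le_coe (le_max_left _ _)
    _ ≤ d := EReal.coe_ennreal_le_coe_ennreal_iff.2 hle

theorem EReal.coe_ennreal_le_coe_of_forall_rat {a : ℝ} (ha0 : 0 ≤ a) (ha1 : a < 1) {d : ENNReal}
    (h : ∀ s : ℚ, a < (s : ℝ) → (s : ℝ) < 1 → d ≤ ENNReal.ofReal s) : (d : EReal) ≤ (a : EReal) := by
  have hle : d ≤ ENNReal.ofReal a := by
    have hd : d ≠ ⊤ := by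
      obtain ⟨s, hs1, hs2⟩ := exists_rat_btwn ha1
      exact ne_top_of_le_ne_top ENNReal.ofReal_ne_top (h s hs1 hs2)
    lift d to NNReal using hd
    rw [← ENNReal.ofReal_coe_nnreal]
    refine ENNReal.ofReal_le_ofReal (le_of_not_gt fun hlt => ?_)
    obtain ⟨s, hs1, hs2⟩ := exists_rat_btwn (lt_min hlt ha1)
    have := h s hs1 (hs2.trans_le (min_le_right _ _))
    rw [← ENNReal.ofReal_coe_nnreal, ENNReal.ofReal_le_ofReal_iff (ha0.trans hs1.le)] at this
    exact absurd (hs2.trans_le (min_le_left _ _)) (not_lt.2 this)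
  calc (d : EReal) ≤ (ENNReal.ofReal a : EReal) := EReal.coe_ennreal_le_coe_ennreal_iff.2 hle
    _ = a := by rw [EReal.coe_ennreal_ofReal, max_eq_left ha0]

theorem mainTheorem3 {Ω : Type*} [MeasurableSpace Ω] (P : Measure Ω) [IsProbabilityMeasure P]
    (G : ℕ → Ω → ℂ) (hG_indep : iIndepFun G P) (hG_law : ∀ j, HasLaw (G j) (stdGaussian ℂ) P)
    (α : ℝ) (hα : 0 < α) :
    (∀ q : ℝ, 1 < q → q < 2 → ∀ᵐ ω ∂P,
      (((1 - α) * Real.logb 2 q : ℝ) : EReal)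
          ≤ (dimH (treeExceptionalSet (fun j => G j ω) α q) : EReal) ∧
        (dimH (treeExceptionalSet (fun j => G j ω) α q) : EReal)
          ≤ ((max (1 - α) 0 : ℝ) : EReal)) ∧
    (∀ q : ℝ, 2 < q → ∀ᵐ ω ∂P,
      (dimH (treeExceptionalSet (fun j => G j ω) α q) : EReal)
        = ((max (1 - α * Real.logb 2 q) 0 : ℝ) : EReal)) := by
  constructor
  · intro q hq hq2
    have hL : 0 < Real.logb 2 q := Real.logb_pos one_lt_two hq
    have hL1 : Real.logb 2 q < 1 := by
      rw [Real.logb_lt_iff_lt_rpow one_lt_two (by linarith), Real.rpow_one]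
      exact hq2
    have hlow : ∀ᵐ ω ∂P, ∀ s : ℚ, 0 < (s : ℝ) → (s : ℝ) < (1 - α) * Real.logb 2 q →
        ENNReal.ofReal s ≤ dimH (treeExceptionalSet (fun j => G j ω) α q) := by
      rw [ae_all_iff]
      intro s
      by_cases hs : 0 < (s : ℝ) ∧ (s : ℝ) < (1 - α) * Real.logb 2 q
      · filter_upwards [ae_le_dimH_treeExceptionalSet_of_lt_two hG_indep hG_law hα hq hq2 hs.1 hs.2]
          with ω hω _ _ using hω
      · exact Eventually.of_forall fun ω h1 h2 => absurd ⟨h1, h2⟩ hs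
    have hup : ∀ᵐ ω ∂P, ∀ s : ℚ, max (1 - α) 0 < (s : ℝ) → (s : ℝ) < 1 →
        dimH (treeExceptionalSet (fun j => G j ω) α q) ≤ ENNReal.ofReal s := by
      rw [ae_all_iff]
      intro s
      by_cases hs : max (1 - α) 0 < (s : ℝ) ∧ (s : ℝ) < 1
      · obtain ⟨h1, h2⟩ := max_lt_iff.1 hs.1
        have h3 : 0 < 1 - (s : ℝ) := sub_pos.2 hs.2
        -- Since s > 1 - α, there is room for λ above log₂ q with λ(1-s) < α log₂ q; q < 2 allows λ
        -- ≤ 1 as well.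
        have h4 : Real.logb 2 q < α * Real.logb 2 q / (1 - s) := by
          rw [lt_div_iff₀ h3]
          nlinarith
        obtain ⟨lam, hlam1, hlam2⟩ := exists_between (lt_min hL1 h4)
        have h5 : lam * (1 - s) < α * Real.logb 2 q :=
          (lt_div_iff₀ h3).1 (hlam2.trans_le (min_le_right _ _))
        filter_upwards [ae_dimH_treeExceptionalSet_le_of_logb_lt hG_indep hG_law hq hlam1
          (hlam2.le.trans (min_le_left _ _)) h2.le hs.2.le h5] with ω hω _ _ using hω
      · exact Eventually.of_forall fun ω h1 h2 => absurd ⟨h1, h2⟩ hs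
    filter_upwards [hlow, hup] with ω h1 h2
    exact ⟨EReal.coe_le_coe_ennreal_of_forall_rat h1, EReal.coe_ennreal_le_coe_of_forall_rat
      (le_max_right _ _) (max_lt (by linarith) one_pos) h2⟩
  · intro q hq
    have hq1 : 1 < q := by linarith
    have hL : 0 < Real.logb 2 q := Real.logb_pos one_lt_two hq1
    have hlow : ∀ᵐ ω ∂P, ∀ s : ℚ, 0 < (s : ℝ) → (s : ℝ) < max (1 - α * Real.logb 2 q) 0 →
        ENNReal.ofReal s ≤ dimH (treeExceptionalSet (fun j => G j ω) α q) := by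
      rw [ae_all_iff]
      intro s
      by_cases hs : 0 < (s : ℝ) ∧ (s : ℝ) < max (1 - α * Real.logb 2 q) 0
      · have h1 : (s : ℝ) < 1 - α * Real.logb 2 q :=
          (lt_max_iff.1 hs.2).resolve_right (not_lt.2 hs.1.le)
        filter_upwards [ae_le_dimH_treeExceptionalSet_of_two_lt hG_indep hG_law hα hq hs.1 h1]
          with ω hω _ _ using hω
      · exact Eventually.of_forall fun ω h1 h2 => absurd ⟨h1, h2⟩ hs
    have hup : ∀ᵐ ω ∂P, ∀ s : ℚ, max (1 - α * Real.logb 2 q) 0 < (s : ℝ) → (s : ℝ) < 1 →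
        dimH (treeExceptionalSet (fun j => G j ω) α q) ≤ ENNReal.ofReal s := by
      rw [ae_all_iff]
      intro s
      by_cases hs : max (1 - α * Real.logb 2 q) 0 < (s : ℝ) ∧ (s : ℝ) < 1
      · obtain ⟨h1, h2⟩ := max_lt_iff.1 hs.1
        filter_upwards [ae_dimH_treeExceptionalSet_le_of_lt (α := α) hG_indep hG_law hq1 h2.le hs.2.le
          (by linarith)] with ω hω _ _ using hω
      · exact Eventually.of_forall fun ω h1 h2 => absurd ⟨h1, h2⟩ hs
    filter_upwards [hlow, hup] with ω h1 h2
    exact le_antisymm (EReal.coe_ennreal_le_coe_of_forall_rat (le_max_right _ _)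
      (max_lt (by nlinarith) one_pos) h2) (EReal.coe_le_coe_ennreal_of_forall_rat h1)
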